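/- Let $k$ be a perfect field of characteristic $p>0$ and let $H$ be a commutative Hopf algebra over $k$ that is finitely generated as a $k$-algebra. Then the nilradical $\operatorname{Nil}H$ is a Hopf ideal; let $H_{\operatorname{red}}:=H/\operatorname{Nil}H$ be the quotient Hopf algebra and $\pi:H\to H_{\operatorname{red}}$ the projection. Regard $H$ as a right $H_{\operatorname{red}}$-comodule algebra by the coaction $h\mapsto h_{(1)}\otimes\pi(h_{(2)})$. If $\operatorname{Nil}H\neq 0$, then there are positive integers $n$ and $e_1,\dots,e_n$ and an isomorphism of right $H_{\operatorname{red}}$-comodule algebras (that is, an $H_{\operatorname{red}}$-colinear isomorphism of $k$-algebras) \[ H\;\cong\;k[T_1,\dots,T_n]/(T_1^{p^{e_1}},\dots,T_n^{p^{e_n}})\otimes_k H_{\operatorname{red}}, \] where the coaction on the right-hand side is $b\otimes a\mapsto b\otimes a_{(1)}\otimes a_{(2)}$. -/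

import Mathlib

open scoped TensorProduct

namespace HopfRed

universe u v w w'

section ComoduleAlgebra

variable {k : Type u} {K : Type v} [Field k] [CommRing K] [Bialgebra k K]

/-- A right `K`-comodule algebra structure on the commutative `k`-algebra `A`: a coaction
`A → A ⊗ K` which is an algebra map and is coassociative and counital. -/
structure ComoduleAlgebra (k : Type u) (K : Type v) (A : Type w) [Field k] [CommRing K]
    [Bialgebra k K] [CommRing A] [Algebra k A] where
  /-- The coaction. -/
  coact : A →ₐ[k] A ⊗[k] K
  coassoc : (Algebra.TensorProduct.assoc k k k A K K).toAlgHom.comp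
      ((Algebra.TensorProduct.map coact (AlgHom.id k K)).comp coact) =
    (Algebra.TensorProduct.map (AlgHom.id k A) (Bialgebra.comulAlgHom k K)).comp coact
  counital : (Algebra.TensorProduct.map (AlgHom.id k A) (Bialgebra.counitAlgHom k K)).comp coact =
    (Algebra.TensorProduct.rid k k A).symm.toAlgHom

/-- An isomorphism of right `K`-comodule algebras: a `K`-colinear algebra isomorphism. -/
structure ComoduleAlgebra.Iso {A : Type w} {B : Type w'} [CommRing A] [Algebra k A] [CommRing B]
    [Algebra k B] (ρ : ComoduleAlgebra k K A) (σ : ComoduleAlgebra k K B) extends A ≃ₐ[k] B where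
  colinear : ∀ a : A, σ.coact (toAlgEquiv a) =
    Algebra.TensorProduct.map toAlgEquiv.toAlgHom (AlgHom.id k K) (ρ.coact a)

/-- Given a bialgebra map `f : H → K`, the algebra `H` is a right `K`-comodule algebra with
coaction `h ↦ h₍₁₎ ⊗ f (h₍₂₎)`. -/
noncomputable def ComoduleAlgebra.ofBialgHom {H : Type w} [CommRing H] [Bialgebra k H]
    (f : H →ₐc[k] K) : ComoduleAlgebra k K H where
  coact := (Algebra.TensorProduct.map (AlgHom.id k H) (f : H →ₐ[k] K)).comp
    (Bialgebra.comulAlgHom k H)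
  coassoc := by
    have hf : (Bialgebra.comulAlgHom k K).comp (f : H →ₐ[k] K) =
        (Algebra.TensorProduct.map (f : H →ₐ[k] K) (f : H →ₐ[k] K)).comp
          (Bialgebra.comulAlgHom k H) :=
      AlgHom.ext fun a => (CoalgHomClass.map_comp_comul_apply f a).symm
    have h1 : ∀ t : H ⊗[k] H, Algebra.TensorProduct.assoc k k k H K K
        (Algebra.TensorProduct.map ((Algebra.TensorProduct.map (AlgHom.id k H)
          (f : H →ₐ[k] K)).comp (Bialgebra.comulAlgHom k H)) (AlgHom.id k K)
            (Algebra.TensorProduct.map (AlgHom.id k H) (f : H →ₐ[k] K) t)) =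
        Algebra.TensorProduct.map (AlgHom.id k H) (Algebra.TensorProduct.map (f : H →ₐ[k] K)
          (f : H →ₐ[k] K)) (TensorProduct.assoc k H H H
            (TensorProduct.map Coalgebra.comul LinearMap.id t)) := by
      intro t
      induction t with
      | zero => simp
      | add x y hx hy => simp only [map_add, hx, hy]
      | tmul x y =>
        simp only [Algebra.TensorProduct.map_tmul, AlgHom.comp_apply, AlgHom.id_apply,
          TensorProduct.map_tmul, LinearMap.id_apply, Bialgebra.comulAlgHom_apply]
        generalize (Coalgebra.comul (R := k) x) = s
        induction s with
        | zero => simp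
        | add x y hx hy => simp only [map_add, TensorProduct.add_tmul, hx, hy]
        | tmul u v => simp
    refine AlgHom.ext fun a => ?_
    refine (h1 (Coalgebra.comul a)).trans ?_
    have h3 : TensorProduct.assoc k H H H
        (TensorProduct.map Coalgebra.comul LinearMap.id (Coalgebra.comul (R := k) a)) =
        Algebra.TensorProduct.map (AlgHom.id k H) (Bialgebra.comulAlgHom k H)
          (Coalgebra.comul (R := k) a) :=
      Coalgebra.coassoc_apply a
    rw [h3]
    simp only [← AlgHom.comp_apply, ← Algebra.TensorProduct.map_comp, ← hf]
    simp only [AlgHom.comp_apply, Bialgebra.comulAlgHom_apply, ← AlgHom.comp_assoc,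
      ← Algebra.TensorProduct.map_comp]
  counital := by
    have hf : (Bialgebra.counitAlgHom k K).comp (f : H →ₐ[k] K) = Bialgebra.counitAlgHom k H :=
      AlgHom.ext fun a => CoalgHomClass.counit_comp_apply f a
    rw [← AlgHom.comp_assoc, ← Algebra.TensorProduct.map_comp, hf]
    exact AlgHom.ext fun a => Coalgebra.lTensor_counit_comul a

/-- For a `k`-algebra `B`, the algebra `B ⊗ K` is a right `K`-comodule algebra with coaction
`b ⊗ x ↦ b ⊗ x₍₁₎ ⊗ x₍₂₎`, that is, `B` is regarded as a trivial comodule. -/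
noncomputable def ComoduleAlgebra.tensor (B : Type w) [CommRing B] [Algebra k B] :
    ComoduleAlgebra k K (B ⊗[k] K) where
  coact := (Algebra.TensorProduct.assoc k k k B K K).symm.toAlgHom.comp
    (Algebra.TensorProduct.map (AlgHom.id k B) (Bialgebra.comulAlgHom k K))
  coassoc := by
    have h1 : ∀ (b : B) (t : K ⊗[k] K), Algebra.TensorProduct.assoc k k k (B ⊗[k] K) K K
        (Algebra.TensorProduct.map ((Algebra.TensorProduct.assoc k k k B K K).symm.toAlgHom.comp
          (Algebra.TensorProduct.map (AlgHom.id k B) (Bialgebra.comulAlgHom k K)))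
          (AlgHom.id k K) ((Algebra.TensorProduct.assoc k k k B K K).symm (b ⊗ₜ t))) =
        (TensorProduct.assoc k B K (K ⊗[k] K)).symm (b ⊗ₜ (TensorProduct.assoc k K K K
          (TensorProduct.map Coalgebra.comul LinearMap.id t))) := by
      intro b t
      induction t with
      | zero => simp
      | add x y hx hy => simp only [map_add, TensorProduct.tmul_add, hx, hy]
      | tmul x y =>
        simp only [Algebra.TensorProduct.map_tmul, AlgHom.comp_apply, AlgHom.id_apply,
          Algebra.TensorProduct.assoc_symm_tmul,
          TensorProduct.map_tmul, LinearMap.id_apply, Bialgebra.comulAlgHom_apply]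
        generalize (Coalgebra.comul (R := k) x) = s
        induction s with
        | zero => simp
        | add x y hx hy => simp only [map_add, TensorProduct.add_tmul, TensorProduct.tmul_add, hx, hy]
        | tmul u v => simp
    have h2 : ∀ (b : B) (t : K ⊗[k] K),
        (Algebra.TensorProduct.map (AlgHom.id k (B ⊗[k] K)) (Bialgebra.comulAlgHom k K))
          ((Algebra.TensorProduct.assoc k k k B K K).symm (b ⊗ₜ t)) =
        (TensorProduct.assoc k B K (K ⊗[k] K)).symm
          (b ⊗ₜ (TensorProduct.map LinearMap.id Coalgebra.comul t)) := by
      intro b t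
      induction t with
      | zero => simp
      | add x y hx hy => simp only [map_add, TensorProduct.tmul_add, hx, hy]
      | tmul x y => simp
    refine AlgHom.ext fun z => ?_
    induction z with
    | zero => simp
    | add x y hx hy => simp only [map_add, hx, hy]
    | tmul b x =>
      refine (h1 b (Coalgebra.comul x)).trans (Eq.trans ?_ (h2 b (Coalgebra.comul x)).symm)
      exact congrArg (fun y => (TensorProduct.assoc k B K (K ⊗[k] K)).symm (b ⊗ₜ y))
        (Coalgebra.coassoc_apply x)
  counital := by
    have h1 : ∀ (b : B) (t : K ⊗[k] K),
        (Algebra.TensorProduct.map (AlgHom.id k (B ⊗[k] K)) (Bialgebra.counitAlgHom k K))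
          ((Algebra.TensorProduct.assoc k k k B K K).symm (b ⊗ₜ t)) =
        (TensorProduct.assoc k B K k).symm
          (b ⊗ₜ (LinearMap.lTensor K Coalgebra.counit t)) := by
      intro b t
      induction t with
      | zero => simp
      | add x y hx hy => simp only [map_add, TensorProduct.tmul_add, hx, hy]
      | tmul x y => simp
    refine AlgHom.ext fun z => ?_
    induction z with
    | zero => simp
    | add x y hx hy => simp only [map_add, hx, hy]
    | tmul b x =>
      refine (h1 b (Coalgebra.comul x)).trans ?_
      rw [Coalgebra.lTensor_counit_comul]
      rfl

end ComoduleAlgebra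

/-- Over a perfect field of characteristic `p`, the tensor product of two reduced algebras is
reduced. -/
theorem isReduced_tensorProduct {k : Type u} [Field k] (p : ℕ) [Fact p.Prime] [CharP k p] [PerfectField k]
    {A : Type v} {B : Type w} [CommRing A] [CommRing B] [Algebra k A] [Algebra k B]
    [IsReduced A] [IsReduced B] : IsReduced (A ⊗[k] B) := by
  classical
  rcases subsingleton_or_nontrivial (A ⊗[k] B) with hs | hn
  · infer_instance
  have : Nontrivial A := by
    by_contra h
    rw [not_nontrivial_iff_subsingleton] at h
    exact not_subsingleton (A ⊗[k] B) inferInstance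
  have : CharP A p := charP_of_injective_algebraMap (algebraMap k A).injective p
  have : CharP (A ⊗[k] B) p :=
    charP_of_injective_algebraMap (algebraMap k (A ⊗[k] B)).injective p
  have : PerfectRing k p := PerfectField.toPerfectRing p
  let e := Module.Basis.ofVectorSpace k A
  have hli : LinearIndependent k (fun i => e i ^ p) := by
    rw [linearIndependent_iff']
    intro s g hg i hi
    choose c hc using fun i => surjective_frobenius k p (g i)
    have h1 : (∑ i ∈ s, c i • e i) ^ p = 0 := by
      rw [sum_pow_char, ← hg]
      refine Finset.sum_congr rfl fun j _ => ?_
      rw [smul_pow, ← frobenius_def, hc]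
    have h2 := (linearIndependent_iff'.1 e.linearIndependent) s c (pow_eq_zero_iff
      (Fact.out : p.Prime).ne_zero |>.1 h1) i hi
    rw [← hc, h2, map_zero]
  have key : ∀ x : A ⊗[k] B, x ^ p = 0 → x = 0 := by
    intro x hx
    obtain ⟨c, rfl⟩ := TensorProduct.eq_repr_basis_left e x
    have hx' : ∑ i ∈ c.support, (e i ^ p) ⊗ₜ[k] (c i ^ p) = 0 := by
      rw [← hx, Finsupp.sum, sum_pow_char]
      simp [Algebra.TensorProduct.tmul_pow]
    obtain ⟨g, hg⟩ := LinearMap.exists_leftInverse_of_injective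
      (Finsupp.linearCombination k (fun i => e i ^ p)) (LinearMap.ker_eq_bot.2 hli)
    have hgi : ∀ i, g (e i ^ p) = Finsupp.single i 1 := fun i => by
      simpa using LinearMap.congr_fun hg (Finsupp.single i 1)
    refine Finset.sum_eq_zero fun i hi => ?_
    have h3 := congrArg (fun y => TensorProduct.lid k B
      (LinearMap.rTensor B (Finsupp.lapply i ∘ₗ g) y)) hx'
    simp only [map_sum, LinearMap.rTensor_tmul, LinearMap.comp_apply, hgi, Finsupp.lapply_apply,
      TensorProduct.lid_tmul, map_zero, Finsupp.single_apply, ite_smul, one_smul, zero_smul] at h3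
    rw [Finset.sum_ite_eq' c.support i, if_pos hi] at h3
    exact (congrArg (fun y => e i ⊗ₜ[k] y) (eq_zero_of_pow_eq_zero h3)).trans
      (TensorProduct.tmul_zero _ _)
  have key' : ∀ (n : ℕ) (x : A ⊗[k] B), x ^ p ^ n = 0 → x = 0 := by
    intro n
    induction n with
    | zero => intro x hx; simpa using hx
    | succ n ih => intro x hx; exact ih x (key _ (by rw [← pow_mul, ← pow_succ]; exact hx))
  refine ⟨fun x ⟨n, hn⟩ => key' n x ?_⟩
  exact pow_eq_zero_of_le (Nat.lt_pow_self (Fact.out : p.Prime).one_lt).le hn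

/-- Over a perfect field of characteristic `p`, the nilradical of a commutative Hopf algebra is a
Hopf ideal. -/
theorem nilradical_isHopfIdeal {k : Type u} [Field k] (p : ℕ) [Fact p.Prime] [CharP k p] [PerfectField k]
    (H : Type v) [CommRing H] [HopfAlgebra k H] :
    (nilradical H).IsHopfIdeal k where
  counit_eq_zero x hx :=
    (((mem_nilradical.1 hx).map (Bialgebra.counitAlgHom k H)).eq_zero :)
  map_mkQ_comul_eq_zero x hx := by
    have : IsReduced (H ⧸ nilradical H) :=
      (Ideal.isRadical_iff_quotient_reduced _).1 (Ideal.radical_isRadical _)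
    have : IsReduced ((H ⧸ nilradical H) ⊗[k] (H ⧸ nilradical H)) :=
      isReduced_tensorProduct p
    exact ((mem_nilradical.1 hx).map ((Algebra.TensorProduct.map
      (Ideal.Quotient.mkₐ k (nilradical H)) (Ideal.Quotient.mkₐ k (nilradical H))).comp
      (Bialgebra.comulAlgHom k H))).eq_zero
  antipode_mem x hx :=
    mem_nilradical.2 ((mem_nilradical.1 hx).map (HopfAlgebra.antipodeAlgHom k H))

/-- The truncated polynomial algebra `k[T₁, …, Tₙ] / (T₁ ^ (p ^ e₁), …, Tₙ ^ (p ^ eₙ))`. -/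
abbrev TruncPoly (k : Type u) [Field k] (p : ℕ) {n : ℕ} (e : Fin n → ℕ) : Type u :=
  MvPolynomial (Fin n) k ⧸
    Ideal.span (Set.range fun i : Fin n => (MvPolynomial.X i : MvPolynomial (Fin n) k) ^ p ^ e i)

end HopfRed

/-!
Write `m` for the augmentation ideal of `H`, `K` for `H_red` and `π` for the projection. An algebra
map `f : H → B` lifts to the colinear map `h ↦ f (h₍₁₎) ⊗ π (h₍₂₎)` from `H` to `B ⊗ K`, so it
suffices to find a truncated polynomial algebra `B` and an `f` whose lift is bijective.

The kernels of the iterated Frobenius maps of `H` induce a filtration of `m / m²`. A basis adapted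
to it consists of nilpotent elements `t j`, with `t j ^ p ^ e j = 0`, and of elements `u i` which
restrict to parameters of `K` at the identity. Invariant derivations dual to such elements show, by
induction on Frobenius quotients, that for large `M` the monomials in the `t j` and `u i` with
exponents less than `p ^ e j` and `p ^ M` form a basis of `H` modulo the `p ^ M`-th powers of `m`.
Hence `u i ↦ 0`, `t j ↦ T j` defines a map `f` onto `B = k[T₁, …, Tₙ] / (T j ^ p ^ e j)`.

Its lift is surjective because it is so modulo the nilpotent ideal generated by `Nil H`. Comparing
dimensions, it is injective modulo `p ^ M`-th powers for all large `M`, so its kernel lies in every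
power of `m`. By Krull's intersection theorem the kernel is killed by some `c` with `ε(c) = 1`, and
as it is stable under the coaction it then vanishes everywhere, not just near the identity.
-/

namespace HopfRed

section ExponentBox

open MvPolynomial

/-- The box of exponent vectors `a` with `a i < N i`, that is, the exponents of the monomials which
form the standard basis of `k[Xᵢ] / (Xᵢ ^ N i)`. -/
noncomputable def exponentBox {ι : Type*} [Fintype ι] (N : ι → ℕ) : Finset (ι →₀ ℕ) :=
  Finset.univ.finsupp fun i => Finset.range (N i)

variable {ι R A : Type*} [CommRing R] [CommRing A]

theorem support_sum_monomial_subset (s : Finset (ι →₀ ℕ)) (c : (ι →₀ ℕ) → R) :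
    (∑ a ∈ s, monomial a (c a)).support ⊆ s := by
  classical
  refine support_sum.trans (Finset.biUnion_subset.2 fun a ha => ?_)
  exact support_monomial_subset.trans (Finset.singleton_subset_iff.2 ha)

theorem coeff_sum_monomial {s : Finset (ι →₀ ℕ)} {a : ι →₀ ℕ} (ha : a ∈ s) (c : (ι →₀ ℕ) → R) :
    (∑ a ∈ s, monomial a (c a)).coeff a = c a := by
  classical
  simp [coeff_sum, coeff_monomial, ha]

open Classical in
/-- The part of `P` with exponents congruent to `b` modulo `p`, divided by `X ^ b` and with `X ^ p`
replaced by `X`: for `b` in the box `[0, p)^ι` these are the digits in `P = ∑ X ^ b P_b(X ^ p)`. -/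
noncomputable def digitPart (p : ℕ) (b : ι →₀ ℕ) (P : MvPolynomial ι R) : MvPolynomial ι R :=
  ∑ c ∈ P.support with c.mapRange (· % p) (Nat.zero_mod p) = b,
    monomial (c.mapRange (· / p) (Nat.zero_div p)) (P.coeff c)

theorem coeff_digitPart {p : ℕ} {b : ι →₀ ℕ} (hb : ∀ i, b i < p) (P : MvPolynomial ι R)
    (a : ι →₀ ℕ) : (digitPart p b P).coeff a = P.coeff (b + p • a) := by
  classical
  have hdigits (c : ι →₀ ℕ) : c.mapRange (· % p) (Nat.zero_mod p) = b ∧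
      c.mapRange (· / p) (Nat.zero_div p) = a ↔ c = b + p • a := by
    simp only [Finsupp.ext_iff, ← forall_and, Finsupp.mapRange_apply, Finsupp.add_apply,
      Finsupp.smul_apply, smul_eq_mul]
    refine forall_congr' fun i => ?_
    rw [and_comm, Nat.div_mod_unique ((Nat.zero_le _).trans_lt (hb i))]
    exact ⟨fun h => h.1.symm, fun h => ⟨h.symm, hb i⟩⟩
  simp only [digitPart, coeff_sum, coeff_monomial]
  rw [← Finset.sum_filter, Finset.filter_filter]
  simp only [hdigits]
  rw [Finset.sum_filter, Finset.sum_ite_eq']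
  simp +contextual [eq_comm]

variable [Fintype ι]

@[simp]
theorem mem_exponentBox {N : ι → ℕ} {a : ι →₀ ℕ} : a ∈ exponentBox N ↔ ∀ i, a i < N i := by
  simp [exponentBox, Finset.mem_finsupp_iff]

theorem card_exponentBox (N : ι → ℕ) : (exponentBox N).card = ∏ i, N i := by
  simp [exponentBox, Finset.card_finsupp]

theorem eval₂_eq_sum_exponentBox (φ : R →+* A) (x : ι → A) {N : ι → ℕ} {P : MvPolynomial ι R}
    (hP : P.support ⊆ exponentBox N) :
    P.eval₂ φ x = ∑ a ∈ exponentBox N, φ (P.coeff a) * ∏ i, x i ^ a i := by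
  rw [eval₂_eq']
  refine Finset.sum_subset hP fun a _ ha => ?_
  rw [notMem_support_iff.1 ha, map_zero, zero_mul]

theorem aeval_eq_sum_exponentBox [Algebra R A] {y : ι → A} {N : ι → ℕ} (hy : ∀ i, y i ^ N i = 0)
    (P : MvPolynomial ι R) :
    aeval y P = ∑ a ∈ exponentBox N, P.coeff a • ∏ i, y i ^ a i := by
  simp only [Algebra.smul_def]
  rw [aeval_def, eval₂_eq']
  refine Finset.sum_congr_of_eq_on_inter (fun a _ ha => ?_) (fun a _ ha => ?_) fun _ _ _ => rfl
  · obtain ⟨i, hi⟩ : ∃ i, N i ≤ a i := by simpa using ha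
    have hyi : y i ^ a i = 0 := pow_eq_zero_of_le hi (hy i)
    rw [Finset.prod_eq_zero (Finset.mem_univ i) hyi, mul_zero]
  · rw [notMem_support_iff.1 ha, map_zero, zero_mul]

theorem eval₂_eq_sum_digitPart {p : ℕ} (hp : 0 < p) (φ : R →+* A) (x : ι → A)
    (P : MvPolynomial ι R) :
    P.eval₂ φ x = ∑ b ∈ exponentBox fun _ : ι => p,
      (digitPart p b P).eval₂ φ (fun i => x i ^ p) * ∏ i, x i ^ b i := by
  classical
  rw [eval₂_eq', ← Finset.sum_fiberwise_of_maps_to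
    (g := fun c : ι →₀ ℕ => c.mapRange (· % p) (Nat.zero_mod p)) (t := exponentBox fun _ : ι => p)
    fun c _ => by simp [Nat.mod_lt _ hp]]
  refine Finset.sum_congr rfl fun b _ => ?_
  rw [digitPart, eval₂_sum, Finset.sum_mul]
  refine Finset.sum_congr rfl fun c hc => ?_
  rw [eval₂_monomial, Finsupp.prod_fintype _ _ fun _ => pow_zero _, mul_assoc,
    ← Finset.prod_mul_distrib]
  refine congrArg _ (Finset.prod_congr rfl fun i _ => ?_)
  rw [← (Finset.mem_filter.1 hc).2, ← pow_mul, ← pow_add, Finsupp.mapRange_apply,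
    Finsupp.mapRange_apply, Nat.div_add_mod]

end ExponentBox

section GermIdeal

variable {R A : Type*} [CommRing R] [CommRing A] [Algebra R A]

/-- The ideal of elements whose germ at the prime `P` vanishes: the kernel of `A → A_P`. -/
noncomputable def germIdeal (P : Ideal A) [P.IsPrime] : Ideal A :=
  RingHom.ker (algebraMap A (Localization.AtPrime P))

variable {P : Ideal A} [P.IsPrime]

theorem mem_germIdeal {y : A} : y ∈ germIdeal P ↔ ∃ s ∉ P, s * y = 0 := by
  rw [germIdeal, RingHom.mem_ker, IsLocalization.map_eq_zero_iff P.primeCompl]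
  exact ⟨fun ⟨s, hs⟩ => ⟨s, s.2, hs⟩, fun ⟨s, hs, h⟩ => ⟨⟨s, hs⟩, h⟩⟩

theorem germIdeal_le : germIdeal P ≤ P := fun y hy => by
  obtain ⟨s, hs, h⟩ := mem_germIdeal.1 hy
  exact (Ideal.IsPrime.mem_or_mem_of_mul_eq_zero ‹_› h).resolve_left hs

theorem mem_germIdeal_of_mul_mem {s y : A} (hs : s ∉ P) (h : s * y ∈ germIdeal P) :
    y ∈ germIdeal P := by
  obtain ⟨r, hr, h⟩ := mem_germIdeal.1 h
  exact mem_germIdeal.2 ⟨r * s, P.primeCompl.mul_mem hr hs, by rwa [mul_assoc]⟩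

theorem derivation_mem_germIdeal (D : Derivation R A A) {y : A} (hy : y ∈ germIdeal P) :
    D y ∈ germIdeal P := by
  obtain ⟨s, hs, h⟩ := mem_germIdeal.1 hy
  refine mem_germIdeal.2 ⟨s * s, P.primeCompl.mul_mem hs hs, ?_⟩
  have hD : s * D y + y * D s = 0 := by simpa [h] using (D.leibniz s y).symm
  linear_combination s * hD - D s * h

theorem map_mem_germIdeal_iff {B : Type*} [CommRing B] (p : ℕ) [Fact p.Prime] [CharP A p]
    {φ : A →+* B} (hφ : Function.Surjective φ) (hker : RingHom.ker φ = RingHom.ker (frobenius A p))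
    {Q : Ideal B} [Q.IsPrime] (hPQ : Q.comap φ = P) {y : A} :
    φ y ∈ germIdeal Q ↔ y ^ p ∈ germIdeal P := by
  have hφ0 (z : A) : φ z = 0 ↔ z ^ p = 0 := by
    rw [← RingHom.mem_ker, hker, RingHom.mem_ker, frobenius_def]
  simp only [mem_germIdeal, ← hPQ, Ideal.mem_comap]
  constructor
  · rintro ⟨s, hs, h⟩
    obtain ⟨s, rfl⟩ := hφ s
    refine ⟨s ^ p, fun h => hs (Ideal.IsPrime.mem_of_pow_mem ‹_› p (map_pow φ s p ▸ h)), ?_⟩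
    rwa [← mul_pow, ← hφ0, map_mul]
  · rintro ⟨s, hs, h⟩
    refine ⟨φ s, hs, ?_⟩
    rw [← map_mul, hφ0, mul_pow]
    obtain ⟨q, hq⟩ := Nat.exists_eq_succ_of_ne_zero (Fact.out : p.Prime).ne_zero
    rw [hq] at h ⊢
    rw [pow_succ, mul_assoc, h, mul_zero]

end GermIdeal

section PIndependence

open MvPolynomial

variable {R A κ : Type*} [CommRing R] [CommRing A] [Algebra R A] [Fintype κ]

theorem det_mul_mem_of_mulVec_mem [DecidableEq κ] {𝔞 : Ideal A} (M : Matrix κ κ A) (w : κ → A)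
    (h : ∀ i, (M.mulVec w) i ∈ 𝔞) (j : κ) : M.det * w j ∈ 𝔞 := by
  have hadj : M.adjugate.mulVec (M.mulVec w) = M.det • w := by
    rw [Matrix.mulVec_mulVec, Matrix.adjugate_mul, Matrix.smul_mulVec, Matrix.one_mulVec]
  rw [← smul_eq_mul, ← Pi.smul_apply, ← hadj]
  exact 𝔞.sum_mem fun i _ => 𝔞.mul_mem_left _ (h i)

variable {p : ℕ} [Fact p.Prime] [CharP A p]

theorem derivation_eval₂_frobenius (D : Derivation R A A) (x : κ → A) (P : MvPolynomial κ A) :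
    D (P.eval₂ (frobenius A p) x) = ∑ j, D (x j) * (pderiv j P).eval₂ (frobenius A p) x := by
  classical
  induction P using MvPolynomial.induction_on with
  | C a => simp [frobenius_def]
  | add P Q hP hQ => simp [hP, hQ, mul_add, Finset.sum_add_distrib]
  | mul_X P i hP =>
    simp only [Derivation.leibniz, pderiv_X, eval₂_add, eval₂_mul, eval₂_X, smul_eq_mul, hP,
      mul_add, Finset.sum_add_distrib, Finset.mul_sum]
    refine congrArg₂ _ ?_ (Finset.sum_congr rfl fun j _ => by ring)
    rw [Finset.sum_eq_single_of_mem i (Finset.mem_univ i) fun j _ hj => by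
      simp [Pi.single_eq_of_ne' hj]]
    simp [mul_comm]

variable {𝔞 : Ideal A}

theorem coeff_pow_mem_of_coeff_pderiv_pow_mem {P : MvPolynomial κ A}
    (hP : P.support ⊆ exponentBox fun _ => p) (h : ∀ j b, (pderiv j P).coeff b ^ p ∈ 𝔞)
    {b : κ →₀ ℕ} (hb : b ≠ 0) : P.coeff b ^ p ∈ 𝔞 := by
  by_cases hPb : P.coeff b = 0
  · rw [hPb, zero_pow (Fact.out : p.Prime).ne_zero]
    exact 𝔞.zero_mem
  obtain ⟨j, hj⟩ := Finsupp.ne_iff.1 hb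
  have hj : 0 < b j := Nat.pos_of_ne_zero hj
  have hunit : IsUnit ((b j : A) ^ p) := by
    refine IsUnit.pow p ((CharP.isUnit_natCast_iff (Fact.out : p.Prime)).2 ?_)
    exact Nat.not_dvd_of_pos_of_lt hj (mem_exponentBox.1 (hP (mem_support_iff.2 hPb)) j)
  have hcoeff : (pderiv j P).coeff (b - Finsupp.single j 1) = P.coeff b * b j := by
    rw [coeff_pderiv, tsub_add_cancel_of_le (Finsupp.single_le_iff.2 hj), Finsupp.tsub_apply,
      Finsupp.single_eq_same, ← Nat.cast_add_one, Nat.sub_add_cancel hj]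
  have hmem := h j (b - Finsupp.single j 1)
  rwa [hcoeff, mul_pow, Ideal.mul_unit_mem_iff_mem _ hunit] at hmem

variable [DecidableEq κ]

theorem eval₂_pderiv_mem {x : κ → A} {D : κ → Derivation R A A} (hD : ∀ i, ∀ y ∈ 𝔞, D i y ∈ 𝔞)
    (hdet : ∀ y, (Matrix.of fun i j => D i (x j)).det * y ∈ 𝔞 → y ∈ 𝔞) {P : MvPolynomial κ A}
    (h : P.eval₂ (frobenius A p) x ∈ 𝔞) (j : κ) :
    (pderiv j P).eval₂ (frobenius A p) x ∈ 𝔞 := by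
  refine hdet _ (det_mul_mem_of_mulVec_mem _ (fun j => (pderiv j P).eval₂ (frobenius A p) x)
    (fun i => ?_) j)
  have hDi := hD i _ h
  rwa [derivation_eval₂_frobenius] at hDi

/-- Monomials with exponents less than `p` in elements `x j` that admit derivations with
nonsingular Jacobian are independent over `p`-th powers. -/
theorem coeff_pow_mem_of_eval₂_frobenius_mem {x : κ → A} {D : κ → Derivation R A A}
    (hD : ∀ i, ∀ y ∈ 𝔞, D i y ∈ 𝔞)
    (hdet : ∀ y, (Matrix.of fun i j => D i (x j)).det * y ∈ 𝔞 → y ∈ 𝔞) {P : MvPolynomial κ A}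
    (hP : P.support ⊆ exponentBox fun _ => p) (h : P.eval₂ (frobenius A p) x ∈ 𝔞)
    (a : κ →₀ ℕ) : P.coeff a ^ p ∈ 𝔞 := by
  obtain ⟨n, hn⟩ : ∃ n, ∀ b ∈ P.support, b.degree < n :=
    ⟨P.totalDegree + 1, fun b hb => Nat.lt_succ_of_le (le_totalDegree hb)⟩
  induction n generalizing P a with
  | zero =>
    rw [notMem_support_iff.1 fun ha => Nat.not_lt_zero _ (hn a ha),
      zero_pow (Fact.out : p.Prime).ne_zero]
    exact 𝔞.zero_mem
  | succ n ih =>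
    have hsupp (j : κ) {b : κ →₀ ℕ} (hb : b ∈ (pderiv j P).support) :
        b + Finsupp.single j 1 ∈ P.support := by
      rw [mem_support_iff, coeff_pderiv] at hb
      exact mem_support_iff.2 (left_ne_zero_of_mul hb)
    have hpderiv (j : κ) (b : κ →₀ ℕ) : (pderiv j P).coeff b ^ p ∈ 𝔞 := by
      refine ih (fun b hb => mem_exponentBox.2 fun i => ?_) (eval₂_pderiv_mem hD hdet h j) b
        fun b hb => ?_
      · exact lt_of_le_of_lt (by simp) (mem_exponentBox.1 (hP (hsupp j hb)) i)
      · have := hn _ (hsupp j hb)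
        rw [map_add, Finsupp.degree_single] at this
        lia
    have hne {b : κ →₀ ℕ} (hb : b ≠ 0) := coeff_pow_mem_of_coeff_pderiv_pow_mem hP hpderiv hb
    rcases eq_or_ne a 0 with rfl | ha
    · have hsum : P.eval₂ (frobenius A p) x - P.coeff 0 ^ p ∈ 𝔞 := by
        rw [eval₂_eq_sum_exponentBox _ _ hP, ← Finset.add_sum_erase _ _
          (mem_exponentBox.2 fun _ => (Fact.out : p.Prime).pos : (0 : κ →₀ ℕ) ∈ _)]
        simp only [frobenius_def, Finsupp.coe_zero, Pi.zero_apply, pow_zero,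
          Finset.prod_const_one, mul_one, add_sub_cancel_left]
        exact 𝔞.sum_mem fun b hb => 𝔞.mul_mem_right _ (hne (Finset.ne_of_mem_erase hb))
      simpa using 𝔞.sub_mem h hsum
    · exact hne ha

end PIndependence

section FrobeniusKernel

variable {k : Type*} [Field k] {p : ℕ} [Fact p.Prime] {A Q : Type*} [CommRing A] [Algebra k A]
  [CommRing Q] [Algebra k Q] {π : A →ₐ[k] Q}

theorem pow_char_eq_zero_of_map_tmul_eq_zero [CharP (A ⊗[k] A) p] (hπ : Function.Surjective π)
    (hker : ∀ y, π y = 0 → y ^ p = 0) {z : A ⊗[k] A}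
    (hz : Algebra.TensorProduct.map π π z = 0) : z ^ p = 0 := by
  suffices h : RingHom.ker (Algebra.TensorProduct.map π π) ≤
    RingHom.ker (frobenius (A ⊗[k] A) p) from h hz
  rw [Algebra.TensorProduct.map_ker π π hπ hπ]
  refine sup_le (Ideal.map_le_iff_le_comap.2 fun a ha => ?_)
    (Ideal.map_le_iff_le_comap.2 fun a ha => ?_) <;>
  · simp [Ideal.mem_comap, RingHom.mem_ker, frobenius_def, hker a ha,
      Algebra.TensorProduct.tmul_pow]

variable [CharP k p] [PerfectField k] [CharP A p]

theorem linearIndependent_pow_char (hπ : ∀ y, y ^ p = 0 → π y = 0) {ι : Type*} {f : ι → A}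
    (hf : LinearIndependent k (π ∘ f)) : LinearIndependent k fun i => f i ^ p := by
  have : PerfectRing k p := PerfectField.toPerfectRing p
  rw [linearIndependent_iff'] at hf ⊢
  intro s g hg i hi
  choose c hc using fun i => surjective_frobenius k p (g i)
  have hpow : (∑ i ∈ s, c i • f i) ^ p = 0 := by
    rw [sum_pow_char, ← hg]
    exact Finset.sum_congr rfl fun j _ => by rw [smul_pow, ← frobenius_def, hc]
  have hsum : ∑ i ∈ s, c i • (π ∘ f) i = 0 := by
    simpa only [map_sum, map_smul, Function.comp_apply] using hπ _ hpow
  rw [← hc, hf s c hsum i hi, map_zero]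

theorem map_tmul_eq_zero_of_pow_char_eq_zero [CharP (A ⊗[k] A) p] (hπ : Function.Surjective π)
    (hker : ∀ y, π y = 0 ↔ y ^ p = 0) {z : A ⊗[k] A} (hz : z ^ p = 0) :
    Algebra.TensorProduct.map π π z = 0 := by
  let e := Module.Basis.ofVectorSpace k Q
  obtain ⟨c, hc⟩ := TensorProduct.eq_repr_basis_right e (Algebra.TensorProduct.map π π z)
  choose f hf using fun i => hπ (e i)
  choose d hd using fun i => hπ (c i)
  have hlift : Algebra.TensorProduct.map π π (z - ∑ i ∈ c.support, d i ⊗ₜ[k] f i) = 0 := by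
    rw [map_sub, ← hc, map_sum, Finsupp.sum, sub_eq_zero]
    simp [hf, hd]
  have hsum : ∑ i ∈ c.support, d i ^ p • ((1 : A) ⊗ₜ[k] (f i ^ p)) = 0 := by
    have hpow := pow_char_eq_zero_of_map_tmul_eq_zero hπ (fun y => (hker y).1) hlift
    rw [sub_pow_char, hz, zero_sub, neg_eq_zero, sum_pow_char] at hpow
    simpa [Algebra.TensorProduct.tmul_pow, TensorProduct.smul_tmul'] using hpow
  have hfe : π ∘ f = e := funext hf
  have hli : LinearIndependent A fun i => (1 : A) ⊗ₜ[k] (f i ^ p) :=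
    Module.Flat.linearIndependent_one_tmul
      (linearIndependent_pow_char (fun y => (hker y).2) (hfe ▸ e.linearIndependent))
  rw [← hc]
  refine Finset.sum_eq_zero fun i hi => ?_
  have hci : c i = 0 := by
    rw [← hd, hker, linearIndependent_iff'.1 hli c.support _ hsum i hi]
  rw [hci]
  exact TensorProduct.zero_tmul _ _

end FrobeniusKernel

section Bialgebra

theorem charP_of_bialgebra (k : Type*) [Field k] (p : ℕ) [CharP k p] (H : Type*) [CommRing H]
    [Bialgebra k H] : CharP H p :=
  have : Nontrivial H := (Bialgebra.counitAlgHom k H).toRingHom.domain_nontrivial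
  charP_of_injective_algebraMap (algebraMap k H).injective p

instance isCoideal_ker_frobenius {k : Type*} [Field k] {p : ℕ} [Fact p.Prime] [CharP k p]
    [PerfectField k] {H : Type*} [CommRing H] [Bialgebra k H] [CharP H p] :
    ((RingHom.ker (frobenius H p)).restrictScalars k).IsCoideal where
  counit_eq_zero x hx := by
    have hx : Bialgebra.counitAlgHom k H x ^ p = 0 := by
      rw [← map_pow, show x ^ p = 0 from hx, map_zero]
    exact eq_zero_of_pow_eq_zero hx
  map_mkQ_comul_eq_zero x hx := by
    have := charP_of_bialgebra k p (H ⊗[k] H)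
    have hx : Bialgebra.comulAlgHom k H x ^ p = 0 := by
      rw [← map_pow, show x ^ p = 0 from hx, map_zero]
    exact map_tmul_eq_zero_of_pow_char_eq_zero
      (Ideal.Quotient.mkₐ_surjective k (RingHom.ker (frobenius H p)))
      (fun _ => Ideal.Quotient.eq_zero_iff_mem) hx

/-- The augmentation ideal of a bialgebra. -/
noncomputable abbrev augIdeal (k H : Type*) [Field k] [CommRing H] [Bialgebra k H] : Ideal H :=
  RingHom.ker (Bialgebra.counitAlgHom k H)

variable {k H K : Type*} [Field k] [CommRing H] [Bialgebra k H] [CommRing K] [Bialgebra k K]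

instance isPrime_augIdeal : (augIdeal k H).IsPrime :=
  RingHom.ker_isPrime (Bialgebra.counitAlgHom k H)

theorem sub_algebraMap_counit_mem_augIdeal (h : H) :
    h - algebraMap k H (Coalgebra.counit h) ∈ augIdeal k H := by
  simp [RingHom.mem_ker]

theorem comap_augIdeal (f : H →ₐc[k] K) : (augIdeal k K).comap f = augIdeal k H := by
  ext y
  simp [RingHom.mem_ker]

theorem map_augIdeal {f : H →ₐc[k] K} (hf : Function.Surjective f) :
    (augIdeal k H).map f = augIdeal k K := by
  rw [← comap_augIdeal f, Ideal.map_comap_of_surjective _ hf]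

/-- The invariant derivation `h ↦ h₍₁₎ d(h₍₂₎)` attached to a point derivation `d`. -/
noncomputable def invariantDerivation (d : H →ₗ[k] k)
    (hd : ∀ a b, d (a * b) =
      Coalgebra.counit (R := k) a * d b + Coalgebra.counit (R := k) b * d a) :
    Derivation k H H :=
  Derivation.mk' ((TensorProduct.rid k H).toLinearMap ∘ₗ d.lTensor H ∘ₗ Coalgebra.comul) <| by
    let R : H ⊗[k] H →ₗ[k] H := (TensorProduct.rid k H).toLinearMap ∘ₗ d.lTensor H
    let E : H ⊗[k] H →ₗ[k] H :=
      (TensorProduct.rid k H).toLinearMap ∘ₗ (Coalgebra.counit (R := k) (A := H)).lTensor H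
    have hmul (s t : H ⊗[k] H) : R (s * t) = E s * R t + E t * R s := by
      induction s with
      | zero => simp
      | add s₁ s₂ h₁ h₂ => simp only [add_mul, map_add, h₁, h₂, mul_add]; ring
      | tmul a b =>
        induction t with
        | zero => simp
        | add s₁ s₂ h₁ h₂ => simp only [add_mul, map_add, h₁, h₂, mul_add]; ring
        | tmul a' b' =>
          simp only [R, E, LinearMap.comp_apply, Algebra.TensorProduct.tmul_mul_tmul,
            LinearMap.lTensor_tmul, LinearEquiv.coe_coe, TensorProduct.rid_tmul, hd,
            Algebra.smul_def, map_add, map_mul]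
          ring
    have hE (a : H) : E (Coalgebra.comul a) = a := by simp [E]
    intro a b
    have := hmul (Coalgebra.comul a) (Coalgebra.comul b)
    rwa [hE, hE, ← Bialgebra.comul_mul] at this

theorem counit_invariantDerivation (d : H →ₗ[k] k)
    (hd : ∀ a b, d (a * b) = Coalgebra.counit (R := k) a * d b + Coalgebra.counit (R := k) b * d a)
    (h : H) : Coalgebra.counit (R := k) (invariantDerivation d hd h) = d h := by
  have hcounit (t : H ⊗[k] H) : Coalgebra.counit (R := k) (TensorProduct.rid k H (d.lTensor H t)) =
      d (TensorProduct.lid k H ((Coalgebra.counit (R := k) (A := H)).rTensor H t)) := by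
    induction t with
    | zero => simp
    | add s₁ s₂ h₁ h₂ => simp only [map_add, h₁, h₂]
    | tmul a b => simp [mul_comm]
  refine (hcounit (Coalgebra.comul h)).trans ?_
  simp

theorem exists_dual_derivations {κ V : Type*} [DecidableEq κ] [AddCommGroup V] [Module k V]
    {x : κ → H} (hx : ∀ i, x i ∈ augIdeal k H) {q : H →ₗ[k] V}
    (hq : ∀ y ∈ augIdeal k H ^ 2, q y = 0) (hind : LinearIndependent k (q ∘ x)) :
    ∃ D : κ → Derivation k H H, ∀ i j,
      Coalgebra.counit (R := k) (D i (x j)) = if i = j then 1 else 0 := by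
  obtain ⟨g, hg⟩ := LinearMap.exists_leftInverse_of_injective _ (LinearMap.ker_eq_bot.2 hind)
  have hgx (j : κ) : g (q (x j)) = Finsupp.single j 1 := by
    simpa using LinearMap.congr_fun hg (Finsupp.single j 1)
  let δ : H →ₗ[k] H := LinearMap.id - Algebra.linearMap k H ∘ₗ Coalgebra.counit
  have hδ (a : H) : δ a ∈ augIdeal k H := sub_algebraMap_counit_mem_augIdeal a
  have hδ_mul (a b : H) : q (δ (a * b)) =
      Coalgebra.counit (R := k) a • q (δ b) + Coalgebra.counit (R := k) b • q (δ a) := by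
    have hexpand : δ (a * b) = δ a * δ b +
        (Coalgebra.counit (R := k) a • δ b + Coalgebra.counit (R := k) b • δ a) := by
      simp only [δ, LinearMap.sub_apply, LinearMap.id_apply, LinearMap.comp_apply,
        Algebra.linearMap_apply, Bialgebra.counit_mul, map_mul, Algebra.smul_def]
      ring
    have hsq : q (δ a * δ b) = 0 :=
      hq _ (pow_two (augIdeal k H) ▸ Ideal.mul_mem_mul (hδ a) (hδ b))
    rw [hexpand, map_add, hsq, zero_add, map_add, map_smul, map_smul]
  let d (i : κ) : H →ₗ[k] k := Finsupp.lapply i ∘ₗ g ∘ₗ q ∘ₗ δ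
  have hd_apply (i : κ) (a : H) : d i a = g (q (δ a)) i := rfl
  have hd_mul (i : κ) (a b : H) : d i (a * b) =
      Coalgebra.counit (R := k) a * d i b + Coalgebra.counit (R := k) b * d i a := by
    simp only [hd_apply, hδ_mul, map_add, map_smul, Finsupp.add_apply, Finsupp.smul_apply,
      smul_eq_mul]
  have hδx (j : κ) : δ (x j) = x j := by
    have : Coalgebra.counit (R := k) (x j) = 0 := hx j
    simp [δ, this]
  refine ⟨fun i => invariantDerivation (d i) (hd_mul i), fun i j => ?_⟩
  simp only [counit_invariantDerivation, hd_apply, hδx, hgx, Finsupp.single_apply, eq_comm]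

theorem det_derivation_notMem_augIdeal {κ : Type*} [Fintype κ] [DecidableEq κ]
    {D : κ → Derivation k H H} {x : κ → H}
    (h : ∀ i j, Coalgebra.counit (R := k) (D i (x j)) = if i = j then 1 else 0) :
    (Matrix.of fun i j => D i (x j)).det ∉ augIdeal k H := by
  have hone : (Bialgebra.counitAlgHom k H).mapMatrix (Matrix.of fun i j => D i (x j)) = 1 := by
    ext i j
    simp [h, Matrix.one_apply]
  rw [RingHom.mem_ker, AlgHom.map_det, hone, Matrix.det_one]
  exact one_ne_zero

end Bialgebra

section Adapted

open MvPolynomial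

theorem linearIndependent_of_ker_le {k V V' V'' ι : Type*} [Field k] [AddCommGroup V] [Module k V]
    [AddCommGroup V'] [Module k V'] [AddCommGroup V''] [Module k V''] {f : V →ₗ[k] V'}
    {g : V →ₗ[k] V''} (h : LinearMap.ker g ≤ LinearMap.ker f) {v : ι → V}
    (hf : LinearIndependent k (f ∘ v)) : LinearIndependent k (g ∘ v) := by
  rw [linearIndependent_iff] at hf ⊢
  intro c hc
  rw [← Finsupp.apply_linearCombination] at hc
  refine hf c ?_
  rw [← Finsupp.apply_linearCombination]
  exact h hc

theorem comap_sq_augIdeal_sup {k H K : Type*} [Field k] [CommRing H] [Bialgebra k H] [CommRing K]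
    [Bialgebra k K] {f : H →ₐc[k] K} (hf : Function.Surjective f) (I : Ideal K) :
    (augIdeal k K ^ 2 ⊔ I).comap f = augIdeal k H ^ 2 ⊔ I.comap f := by
  have hmap : (augIdeal k H ^ 2 ⊔ I.comap f).map f = augIdeal k K ^ 2 ⊔ I := by
    rw [Ideal.map_sup, Ideal.map_pow, map_augIdeal hf, Ideal.map_comap_of_surjective _ hf]
  rw [← hmap, Ideal.comap_map_of_surjective _ hf, sup_eq_left]
  exact (Ideal.comap_mono bot_le).trans le_sup_right

variable {k : Type*} [Field k] {p : ℕ} [Fact p.Prime] {H : Type*} [CommRing H] [Bialgebra k H]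
  [CharP H p] {ι : Type*} {x : ι → H} {e : ι → ℕ}

/-- Elements `x i` of the augmentation ideal `m` are adapted to the exponents `e i` if for every `s`
those with `s < e i` are linearly independent modulo `m ^ 2` and the kernel of the `s`-th power of
Frobenius. -/
structure IsAdapted (k : Type*) [Field k] (p : ℕ) [Fact p.Prime] {H : Type*} [CommRing H]
    [Bialgebra k H] [CharP H p] {ι : Type*} (x : ι → H) (e : ι → ℕ) : Prop where
  mem_augIdeal : ∀ i, x i ∈ augIdeal k H
  linearIndependent : ∀ s, LinearIndependent k fun i : {i // s < e i} =>
    Ideal.Quotient.mkₐ k (augIdeal k H ^ 2 ⊔ RingHom.ker (iterateFrobenius H p s)) (x i)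

theorem IsAdapted.comp_of_ker_eq_ker_frobenius (hA : IsAdapted k p x e) {Q : Type*} [CommRing Q]
    [Bialgebra k Q] [CharP Q p] {π : H →ₐc[k] Q} (hπ : Function.Surjective π)
    (hker : RingHom.ker π = RingHom.ker (frobenius H p)) :
    IsAdapted k p (π ∘ x) (fun i => e i - 1) where
  mem_augIdeal i := by
    rw [Function.comp_apply, ← Ideal.mem_comap, comap_augIdeal]
    exact hA.mem_augIdeal i
  linearIndependent s := by
    have hcomap : (RingHom.ker (iterateFrobenius Q p s)).comap π =
        RingHom.ker (iterateFrobenius H p (s + 1)) := by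
      ext y
      rw [Ideal.mem_comap, RingHom.mem_ker, RingHom.mem_ker, iterateFrobenius_def,
        iterateFrobenius_def, pow_succ, pow_mul, ← map_pow, ← RingHom.mem_ker, hker,
        RingHom.mem_ker, frobenius_def]
    have hlt (i : {i // s < e i - 1}) : s + 1 < e i := by have := i.2; omega
    have hli := (hA.linearIndependent (s + 1)).comp (fun i : {i // s < e i - 1} => ⟨i, hlt i⟩)
      fun i j hij => Subtype.ext (Subtype.mk_eq_mk.1 hij)
    rw [← hcomap, ← comap_sq_augIdeal_sup hπ] at hli
    let J := augIdeal k Q ^ 2 ⊔ RingHom.ker (iterateFrobenius Q p s)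
    exact linearIndependent_of_ker_le (f := (Ideal.Quotient.mkₐ k (J.comap π)).toLinearMap)
      (g := ((Ideal.Quotient.mkₐ k J).comp (π : H →ₐ[k] Q)).toLinearMap)
      (fun y (hy : Ideal.Quotient.mk J (π y) = 0) =>
        Ideal.Quotient.eq_zero_iff_mem.2 (Ideal.Quotient.eq_zero_iff_mem.1 hy :)) hli

theorem IsAdapted.coeff_pow_mem_germIdeal_of_lt_char [Fintype ι] (hA : IsAdapted k p x e)
    {P : MvPolynomial ι H} (hP : P.support ⊆ exponentBox fun i => p ^ min (e i) 1)
    (h : P.eval₂ (frobenius H p) x ∈ germIdeal (augIdeal k H)) (a : ι →₀ ℕ) :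
    P.coeff a ^ p ∈ germIdeal (augIdeal k H) := by
  classical
  have hvars : (P.vars : Set ι) ⊆ Set.range (Subtype.val : {i // 0 < e i} → ι) := by
    intro i hi
    obtain ⟨b, hb, hi⟩ := (mem_vars_iff_mem_support i).1 hi
    have hbi := mem_exponentBox.1 (hP hb) i
    refine ⟨⟨i, Nat.pos_of_ne_zero fun hei => ?_⟩, rfl⟩
    rw [hei, Nat.zero_min, pow_zero, Nat.lt_one_iff] at hbi
    exact Finsupp.mem_support_iff.1 hi hbi
  obtain ⟨P, rfl⟩ := exists_rename_eq_of_vars_subset_range P _ Subtype.val_injective hvars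
  have hbox : P.support ⊆ exponentBox fun _ => p := by
    intro b hb
    rw [mem_support_iff, ← coeff_rename_mapDomain _ Subtype.val_injective, ← mem_support_iff] at hb
    refine mem_exponentBox.2 fun i => ?_
    have hbi := mem_exponentBox.1 (hP hb) i
    rw [Finsupp.mapDomain_apply Subtype.val_injective] at hbi
    exact hbi.trans_le ((Nat.pow_le_pow_right (Fact.out : p.Prime).pos
      (min_le_right _ _)).trans (pow_one p).le)
  obtain ⟨D, hD⟩ := exists_dual_derivations (fun i => hA.mem_augIdeal _)
    (q := (Ideal.Quotient.mkₐ k _).toLinearMap)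
    (fun y hy => Ideal.Quotient.eq_zero_iff_mem.2 (Ideal.mem_sup_left hy)) (hA.linearIndependent 0)
  rw [eval₂_rename] at h
  have hcoeff := coeff_pow_mem_of_eval₂_frobenius_mem
    (fun i y hy => derivation_mem_germIdeal (D i) hy)
    (fun y hy => mem_germIdeal_of_mul_mem (det_derivation_notMem_augIdeal hD) hy) hbox h
  by_cases ha : ∃ b : {i // 0 < e i} →₀ ℕ, Finsupp.mapDomain Subtype.val b = a
  · obtain ⟨b, rfl⟩ := ha
    rw [coeff_rename_mapDomain _ Subtype.val_injective]
    exact hcoeff b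
  · rw [coeff_rename_eq_zero _ _ _ fun b hb => absurd ⟨b, hb⟩ ha,
      zero_pow (Fact.out : p.Prime).ne_zero]
    exact Ideal.zero_mem _

theorem lt_of_coeff_digitPart_ne_zero [Fintype ι] {R : Type*} [CommRing R] {P : MvPolynomial ι R}
    (hP : P.support ⊆ exponentBox fun i => p ^ e i) {a b : ι →₀ ℕ} (hb : ∀ i, b i < p)
    (hab : (digitPart p b P).coeff a ≠ 0) (i : ι) :
    a i < p ^ (e i - 1) ∧ b i < p ^ min (e i) 1 := by
  rw [coeff_digitPart hb, ← mem_support_iff] at hab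
  have hlt : b i + p * a i < p ^ e i := mem_exponentBox.1 (hP hab) i
  rcases Nat.eq_zero_or_pos (e i) with hei | hei
  · simp only [hei, pow_zero, Nat.lt_one_iff, Nat.add_eq_zero_iff, mul_eq_zero] at hlt
    simp [hei, hlt.1, hlt.2.resolve_left (Fact.out : p.Prime).ne_zero]
  · rw [min_eq_right hei, pow_one]
    refine ⟨lt_of_mul_lt_mul_left (a := p) ?_ (Nat.zero_le p), hb i⟩
    rw [← pow_succ', Nat.sub_add_cancel hei]
    exact (Nat.le_add_left _ _).trans_lt hlt

theorem IsAdapted.eval₂_digitPart_pow_mem_germIdeal [Fintype ι] (hA : IsAdapted k p x e) {M : ℕ}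
    {P : MvPolynomial ι H} (hP : P.support ⊆ exponentBox fun i => p ^ e i)
    (h : P.eval₂ (iterateFrobenius H p (M + 1)) x ∈ germIdeal (augIdeal k H)) {b : ι →₀ ℕ}
    (hb : ∀ i, b i < p) :
    (digitPart p b P).eval₂ (iterateFrobenius H p M) x ^ p ∈ germIdeal (augIdeal k H) := by
  let c (b : ι →₀ ℕ) : H := (digitPart p b P).eval₂ (iterateFrobenius H p M) x
  let R : MvPolynomial ι H := ∑ b ∈ exponentBox fun _ => p, monomial b (c b)
  have hR {b : ι →₀ ℕ} (hb : b ∈ exponentBox fun _ => p) : R.coeff b = c b :=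
    coeff_sum_monomial hb c
  have hRbox : R.support ⊆ exponentBox fun _ => p := support_sum_monomial_subset _ _
  have hRsupp : R.support ⊆ exponentBox fun i => p ^ min (e i) 1 := by
    intro b hbR
    have hbp := mem_exponentBox.1 (hRbox hbR)
    have hcb : c b ≠ 0 := hR (hRbox hbR) ▸ mem_support_iff.1 hbR
    obtain ⟨a, ha⟩ : ∃ a, (digitPart p b P).coeff a ≠ 0 :=
      ne_zero_iff.1 fun h0 => hcb (by simp only [c, h0, eval₂_zero])
    exact mem_exponentBox.2 fun i => (lt_of_coeff_digitPart_ne_zero hP hbp ha i).2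
  have hReval : R.eval₂ (frobenius H p) x = P.eval₂ (iterateFrobenius H p (M + 1)) x := by
    rw [eval₂_eq_sum_exponentBox _ _ hRbox, eval₂_eq_sum_digitPart (Fact.out : p.Prime).pos]
    refine Finset.sum_congr rfl fun b hb => ?_
    rw [hR hb, eval₂_comp_left]
    congr 2
    ext y
    simp [frobenius_def, iterateFrobenius_def, pow_succ, pow_mul]
  rw [← hReval] at h
  have hcoeff := hA.coeff_pow_mem_germIdeal_of_lt_char hRsupp h b
  rwa [hR (mem_exponentBox.2 hb)] at hcoeff

/-- Monomials in adapted elements with exponents bounded by `p ^ e i` are linearly independent over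
`p ^ M`-th powers, up to germs at the identity. -/
theorem IsAdapted.coeff_pow_mem_germIdeal [CharP k p] [PerfectField k] [Fintype ι]
    (hA : IsAdapted k p x e) {M : ℕ} (he : ∀ i, e i ≤ M) {P : MvPolynomial ι H}
    (hP : P.support ⊆ exponentBox fun i => p ^ e i)
    (h : P.eval₂ (iterateFrobenius H p M) x ∈ germIdeal (augIdeal k H)) (a : ι →₀ ℕ) :
    P.coeff a ^ p ^ M ∈ germIdeal (augIdeal k H) := by
  induction M generalizing H e a with
  | zero =>
    have hbox : (exponentBox fun i => p ^ e i) = {0} := by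
      ext b
      simp [Nat.le_zero.1 (he _), Finsupp.ext_iff]
    by_cases ha : P.coeff a = 0
    · simp [ha]
    · have ha0 : a = 0 := by simpa only [hbox, Finset.mem_singleton] using hP (mem_support_iff.2 ha)
      rw [eval₂_eq_sum_exponentBox _ _ hP, hbox, Finset.sum_singleton] at h
      simpa [ha0, iterateFrobenius_def] using h
  | succ M ih =>
    let Q := H ⧸ RingHom.ker (frobenius H p)
    have : CharP Q p := charP_of_bialgebra k p Q
    let π : H →ₐc[k] Q := Bialgebra.Quotient.mkBialgHom (RingHom.ker (frobenius H p))
    have hπ : Function.Surjective π := Ideal.Quotient.mk_surjective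
    have hker : RingHom.ker π = RingHom.ker (frobenius H p) := Ideal.mk_ker
    have hgerm (y : H) : π y ∈ germIdeal (augIdeal k Q) ↔ y ^ p ∈ germIdeal (augIdeal k H) :=
      map_mem_germIdeal_iff p (φ := (π : H →+* Q)) hπ hker (comap_augIdeal π)
    let b := a.mapRange (· % p) (Nat.zero_mod p)
    let c := a.mapRange (· / p) (Nat.zero_div p)
    have hb (i : ι) : b i < p := Nat.mod_lt _ (Fact.out : p.Prime).pos
    have hcoeff : (digitPart p b P).coeff c = P.coeff a := by
      rw [coeff_digitPart hb]
      exact congrArg _ (Finsupp.ext fun i => Nat.mod_add_div (a i) p)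
    have hdigit := (hgerm _).2 (hA.eval₂_digitPart_pow_mem_germIdeal hP h hb)
    have hcomp : (π : H →+* Q).comp (iterateFrobenius H p M) =
        (iterateFrobenius Q p M).comp (π : H →+* Q) := by
      ext y
      simp [iterateFrobenius_def]
    rw [← RingHom.coe_coe π, eval₂_comp_left, hcomp, ← eval₂_map] at hdigit
    have hbox : ((digitPart p b P).map (π : H →+* Q)).support ⊆
        exponentBox fun i => p ^ (e i - 1) := fun a ha => mem_exponentBox.2 fun i =>
      (lt_of_coeff_digitPart_ne_zero hP hb
        (mem_support_iff.1 (support_map_subset (π : H →+* Q) _ ha)) i).1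
    have hmap := ih (hA.comp_of_ker_eq_ker_frobenius hπ hker) (fun i => by have := he i; omega)
      hbox hdigit c
    rwa [coeff_map, hcoeff, RingHom.coe_coe, ← map_pow, hgerm, ← pow_mul, ← pow_succ] at hmap

end Adapted

section Nakayama

theorem le_sup_pow_smul {R M : Type*} [CommRing R] [AddCommGroup M] [Module R M] {I : Ideal R}
    {N N' : Submodule R M} (h : N' ≤ N ⊔ I • N') (n : ℕ) : N' ≤ N ⊔ I ^ n • N' := by
  induction n with
  | zero => simp
  | succ n ih =>
    calc N' ≤ N ⊔ I • N' := h
      _ ≤ N ⊔ I • (N ⊔ I ^ n • N') := sup_le_sup_left (Submodule.smul_mono le_rfl ih) _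
      _ = N ⊔ I • N ⊔ I ^ (n + 1) • N' := by
        rw [Submodule.smul_sup, ← Submodule.mul_smul, ← pow_succ', sup_assoc]
      _ = N ⊔ I ^ (n + 1) • N' := by rw [sup_eq_left.2 (Submodule.smul_le_right : I • N ≤ N)]

variable {R S : Type*} [CommRing R] [CommRing S] {φ : R →+* S} {I : Ideal R}

theorem surjective_of_isNilpotent_map (hI : IsNilpotent (I.map φ))
    (h : ∀ s, ∃ r, s - φ r ∈ I.map φ) : Function.Surjective φ := by
  let _ := φ.toAlgebra
  have htop : (⊤ : Submodule R S) ≤ LinearMap.range (Algebra.linearMap R S) ⊔ I • ⊤ := by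
    intro s _
    obtain ⟨r, hr⟩ := h s
    rw [← add_sub_cancel (φ r) s]
    refine Submodule.add_mem_sup ⟨r, rfl⟩ ?_
    rw [Ideal.smul_top_eq_map]
    exact hr
  obtain ⟨n, hn⟩ := hI
  have hbot : (I ^ n • ⊤ : Submodule R S) = ⊥ := by
    rw [Ideal.smul_top_eq_map, Ideal.map_pow]
    exact (Submodule.restrictScalars_eq_bot_iff ..).2 hn
  have hrange := le_sup_pow_smul htop n
  rw [hbot, sup_bot_eq] at hrange
  exact fun s => hrange Submodule.mem_top

theorem exists_sub_one_mem_forall_mul_eq_sum (hφ : φ.Finite) {α : Type*} {s : Finset α}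
    {y : α → S} (hy : ∀ h, ∃ c : α → R, h - ∑ a ∈ s, φ (c a) * y a ∈ I.map φ) :
    ∃ r, r - 1 ∈ I ∧ ∀ j ∈ I.map φ, ∃ d : α → R, (∀ a, d a ∈ I) ∧
      φ r * j = ∑ a ∈ s, φ (d a) * y a := by
  classical
  let _ := φ.toAlgebra
  have hfin : Module.Finite R S := hφ
  have htop : (⊤ : Submodule R S) ≤ Submodule.span R (y '' s) ⊔ I • ⊤ := by
    intro h _
    obtain ⟨c, hc⟩ := hy h
    rw [← add_sub_cancel (∑ a ∈ s, φ (c a) * y a) h]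
    refine Submodule.add_mem_sup (Submodule.sum_mem _ fun a ha => ?_) ?_
    · exact Submodule.smul_mem _ (c a) (Submodule.subset_span ⟨a, ha, rfl⟩)
    · rw [Ideal.smul_top_eq_map]
      exact hc
  obtain ⟨r, hr, hle⟩ := Submodule.exists_sub_one_mem_and_smul_le_of_fg_of_le_sup
    hfin.1 le_rfl htop
  refine ⟨r, hr, fun j hj => ?_⟩
  have hmem : r • j ∈ I • Submodule.span R (y '' s) := by
    have hj : j ∈ (I • ⊤ : Submodule R S) := by rwa [Ideal.smul_top_eq_map]
    refine Submodule.smul_mono le_rfl hle ?_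
    rw [Submodule.pointwise_smul_def, ← Submodule.map_smul'']
    exact Submodule.smul_mem_pointwise_smul j r _ hj
  obtain ⟨d, hd, hsum⟩ := (Submodule.mem_ideal_smul_span_iff_exists_sum' _ _ _ _).1 hmem
  refine ⟨fun a => if ha : a ∈ s then d ⟨a, ha⟩ else 0, fun a => ?_, hsum.symm.trans ?_⟩
  · dsimp only
    split_ifs
    exacts [hd _, I.zero_mem]
  · refine (Finsupp.sum_fintype d (fun a c => c • y a) fun _ => zero_smul R _).trans ?_
    rw [← Finset.sum_coe_sort s]
    refine Finset.sum_congr rfl fun a _ => ?_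
    simp only [Finset.coe_mem, dif_pos]
    rfl

theorem aeval_mkₐ_surjective {k A ι : Type*} [Field k] [CommRing A] [Algebra k A] {m J : Ideal A}
    (hm : ∀ y, ∃ c : k, y - algebraMap k A c ∈ m) {x : ι → A} (hx : ∀ i, x i ∈ m)
    (hgen : m ≤ Ideal.span (Set.range x) ⊔ m ^ 2) {n : ℕ} (hJ : m ^ n ≤ J) :
    Function.Surjective (MvPolynomial.aeval fun i => Ideal.Quotient.mkₐ k J (x i) :
      MvPolynomial ι k →ₐ[k] A ⧸ J) := by
  let φ : MvPolynomial ι k →ₐ[k] A ⧸ J := MvPolynomial.aeval fun i => Ideal.Quotient.mkₐ k J (x i)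
  have hmap : (Ideal.span (Set.range MvPolynomial.X)).map (φ : MvPolynomial ι k →+* A ⧸ J) =
      (Ideal.span (Set.range x)).map (Ideal.Quotient.mk J) := by
    rw [Ideal.map_span, Ideal.map_span, ← Set.range_comp, ← Set.range_comp]
    congr 2
    ext i
    exact MvPolynomial.aeval_X _ i
  have hspan : Ideal.span (Set.range x) ≤ m := Ideal.span_le.2 (Set.range_subset_iff.2 hx)
  have hle : m ≤ Ideal.span (Set.range x) ⊔ J := by
    rw [pow_two] at hgen
    refine (le_sup_pow_smul hgen n).trans (sup_le_sup_left ?_ _)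
    exact Ideal.mul_le_left.trans hJ
  refine surjective_of_isNilpotent_map (φ := (φ : MvPolynomial ι k →+* A ⧸ J))
    (I := Ideal.span (Set.range MvPolynomial.X)) ⟨n, ?_⟩ fun y => ?_
  · rw [hmap, ← Ideal.map_pow, Ideal.zero_eq_bot, Ideal.map_eq_bot_iff_le_ker, Ideal.mk_ker]
    exact (Ideal.pow_right_mono hspan n).trans hJ
  · obtain ⟨y, rfl⟩ := Ideal.Quotient.mk_surjective y
    obtain ⟨c, hc⟩ := hm y
    refine ⟨MvPolynomial.C c, ?_⟩
    have hC : (φ : MvPolynomial ι k →+* A ⧸ J) (MvPolynomial.C c) =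
        Ideal.Quotient.mk J (algebraMap k A c) := MvPolynomial.aeval_C _ c
    rw [hmap, hC, ← map_sub]
    have := Ideal.mem_map_of_mem (Ideal.Quotient.mk J) (hle hc)
    rwa [Ideal.map_sup, Ideal.map_quotient_self, sup_bot_eq] at this

end Nakayama

section TruncatedPolynomial

open MvPolynomial

variable {k A ι : Type*} [Field k] [CommRing A] [Algebra k A] {y : ι → A} {N : ι → ℕ}

theorem span_exponentBox_eq_top [Fintype ι] (hy : ∀ i, y i ^ N i = 0)
    (hsurj : Function.Surjective (aeval y : MvPolynomial ι k →ₐ[k] A)) :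
    Submodule.span k ((fun a : ι →₀ ℕ => ∏ i, y i ^ a i) '' exponentBox N) = ⊤ := by
  refine eq_top_iff.2 fun b _ => ?_
  obtain ⟨P, rfl⟩ := hsurj b
  rw [aeval_eq_sum_exponentBox hy]
  exact Submodule.sum_mem _ fun a ha =>
    Submodule.smul_mem _ _ (Submodule.subset_span ⟨a, ha, rfl⟩)

theorem finite_of_aeval_surjective [Finite ι] (hy : ∀ i, y i ^ N i = 0)
    (hsurj : Function.Surjective (aeval y : MvPolynomial ι k →ₐ[k] A)) : Module.Finite k A :=
  have := Fintype.ofFinite ι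
  .of_fg_top (span_exponentBox_eq_top hy hsurj ▸
    Submodule.fg_span ((exponentBox N).finite_toSet.image _))

variable [Fintype ι]

/-- The elements `y i` present the algebra `A` as the truncated polynomial algebra
`k[Xᵢ] / (Xᵢ ^ N i)`. -/
structure IsTruncatedPolynomial (k : Type*) {A ι : Type*} [Field k] [CommRing A] [Algebra k A]
    [Fintype ι] (y : ι → A) (N : ι → ℕ) : Prop where
  pow_eq_zero : ∀ i, y i ^ N i = 0
  aeval_surjective : Function.Surjective (aeval y : MvPolynomial ι k →ₐ[k] A)
  linearIndepOn : LinearIndepOn k (fun a : ι →₀ ℕ => ∏ i, y i ^ a i) (exponentBox N)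

theorem IsTruncatedPolynomial.exists_algHom (h : IsTruncatedPolynomial k y N) {B : Type*}
    [CommRing B] [Algebra k B] {z : ι → B} (hz : ∀ i, z i ^ N i = 0) :
    ∃ f : A →ₐ[k] B, ∀ i, f (y i) = z i := by
  have hker : RingHom.ker (aeval y : MvPolynomial ι k →ₐ[k] A) ≤
      RingHom.ker (aeval z : MvPolynomial ι k →ₐ[k] B) := by
    intro P hP
    rw [RingHom.mem_ker, aeval_eq_sum_exponentBox h.pow_eq_zero] at hP
    rw [RingHom.mem_ker, aeval_eq_sum_exponentBox hz]
    refine Finset.sum_eq_zero fun a ha => ?_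
    rw [linearIndepOn_finset_iff.1 h.linearIndepOn _ hP a ha, zero_smul]
  refine ⟨AlgHom.liftOfSurjective _ h.aeval_surjective (aeval z) hker, fun i => ?_⟩
  simpa only [aeval_X] using
    AlgHom.liftOfSurjective_apply (aeval y) h.aeval_surjective (aeval z) hker (X i)

theorem IsTruncatedPolynomial.finrank_eq (h : IsTruncatedPolynomial k y N) :
    Module.finrank k A = ∏ i, N i := by
  rw [← finrank_top k A, ← span_exponentBox_eq_top h.pow_eq_zero h.aeval_surjective,
    Set.image_eq_range,
    finrank_span_eq_card h.linearIndepOn.linearIndependent, ← card_exponentBox]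
  exact Fintype.card_coe _

/-- The class of `X i` in the truncated polynomial algebra. -/
noncomputable def TruncPoly.gen (k : Type*) [Field k] (p : ℕ) {n : ℕ} (e : Fin n → ℕ)
    (i : Fin n) : TruncPoly k p e :=
  Ideal.Quotient.mkₐ k _ (X i)

theorem TruncPoly.isTruncatedPolynomial_gen (k : Type*) [Field k] (p : ℕ) {n : ℕ}
    (e : Fin n → ℕ) : IsTruncatedPolynomial k (TruncPoly.gen k p e) fun i => p ^ e i := by
  have hpow (i : Fin n) : TruncPoly.gen k p e i ^ p ^ e i = 0 := by
    rw [TruncPoly.gen, ← map_pow]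
    exact Ideal.Quotient.eq_zero_iff_mem.2 (Ideal.subset_span ⟨i, rfl⟩)
  have haeval : aeval (TruncPoly.gen k p e) = Ideal.Quotient.mkₐ k _ :=
    MvPolynomial.algHom_ext fun i => aeval_X _ i
  refine ⟨hpow, haeval ▸ Ideal.Quotient.mkₐ_surjective k _, linearIndepOn_finset_iff.2 ?_⟩
  intro c hc a ha
  let P : MvPolynomial (Fin n) k := ∑ a ∈ exponentBox fun i => p ^ e i, monomial a (c a)
  have hcoeff {a} (ha : a ∈ exponentBox fun i => p ^ e i) : P.coeff a = c a :=
    coeff_sum_monomial ha c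
  have hP : aeval (TruncPoly.gen k p e) P = 0 := by
    rw [aeval_eq_sum_exponentBox hpow, ← hc]
    exact Finset.sum_congr rfl fun a ha => by rw [hcoeff ha]
  have hspan : P ∈ Ideal.span ((fun s => monomial s (1 : k)) ''
      Set.range fun i : Fin n => Finsupp.single i (p ^ e i)) := by
    rw [← Set.range_comp]
    simp only [Function.comp_def, ← X_pow_eq_monomial]
    rw [haeval] at hP
    exact Ideal.Quotient.eq_zero_iff_mem.1 hP
  by_contra hne
  rw [← hcoeff ha, ← ne_eq, ← mem_support_iff] at hne
  obtain ⟨_, ⟨i, rfl⟩, hi⟩ := mem_ideal_span_monomial_image.1 hspan _ hne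
  exact (Finsupp.single_le_iff.1 hi).not_gt (mem_exponentBox.1 ha i)

end TruncatedPolynomial

section FrobeniusPower

open MvPolynomial

theorem iterateFrobenius_finite (k : Type*) [Field k] (p : ℕ) [Fact p.Prime] [CharP k p]
    [PerfectField k] (A : Type*) [CommRing A] [Algebra k A] [CharP A p] [Algebra.FiniteType k A]
    (M : ℕ) : (iterateFrobenius A p M).Finite := by
  have : PerfectRing k p := PerfectField.toPerfectRing p
  refine RingHom.IsIntegral.to_finite (fun x => ⟨.X ^ p ^ M - .C x, ?_, ?_⟩) ?_
  · exact Polynomial.monic_X_pow_sub_C x (pow_ne_zero _ (Fact.out : p.Prime).ne_zero)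
  · simp [iterateFrobenius_def]
  · refine .of_comp_finiteType (f := algebraMap k A) ?_
    rw [← RingHom.iterateFrobenius_comm]
    refine .comp (RingHom.finiteType_algebraMap.2 inferInstance) (.of_surjective _ ?_)
    exact (iterateFrobeniusEquiv k p M).surjective

/-- The ideal generated by the `p ^ M`-th powers of elements of the augmentation ideal. -/
noncomputable abbrev augFrobPow (k : Type*) [Field k] (p : ℕ) [Fact p.Prime] (H : Type*)
    [CommRing H] [Bialgebra k H] [CharP H p] (M : ℕ) : Ideal H :=
  (augIdeal k H).map (iterateFrobenius H p M)

variable {k H : Type*} [Field k] [CommRing H] [Bialgebra k H] {p : ℕ} [Fact p.Prime] [CharP H p]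

theorem pow_mem_augFrobPow {x : H} (hx : x ∈ augIdeal k H) (M : ℕ) :
    x ^ p ^ M ∈ augFrobPow k p H M :=
  Ideal.mem_map_of_mem (iterateFrobenius H p M) hx

theorem exists_augIdeal_pow_le_augFrobPow [IsNoetherianRing H] (M : ℕ) :
    ∃ n, augIdeal k H ^ n ≤ augFrobPow k p H M :=
  Ideal.exists_pow_le_of_le_radical_of_fg (fun _ hx => ⟨p ^ M, pow_mem_augFrobPow hx M⟩)
    (IsNoetherian.noetherian _)

variable {ι : Type*} [Fintype ι] {x : ι → H} {e : ι → ℕ} [CharP k p] [PerfectField k]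

theorem IsAdapted.mem_augIdeal_of_sum_eq_zero (hA : IsAdapted k p x e) {M : ℕ}
    (he : ∀ i, e i ≤ M) {f : (ι →₀ ℕ) → H}
    (hf : ∑ a ∈ exponentBox (fun i => p ^ e i), f a ^ p ^ M * ∏ i, x i ^ a i = 0) {a : ι →₀ ℕ}
    (ha : a ∈ exponentBox fun i => p ^ e i) : f a ∈ augIdeal k H := by
  let P : MvPolynomial ι H := ∑ a ∈ exponentBox fun i => p ^ e i, monomial a (f a)
  have hP : P.support ⊆ exponentBox fun i => p ^ e i := support_sum_monomial_subset _ _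
  have heval : P.eval₂ (iterateFrobenius H p M) x = 0 := by
    rw [eval₂_eq_sum_exponentBox _ _ hP, ← hf]
    refine Finset.sum_congr rfl fun a ha => ?_
    rw [coeff_sum_monomial ha, iterateFrobenius_def]
  have hcoeff := hA.coeff_pow_mem_germIdeal he hP (heval ▸ Ideal.zero_mem _) a
  rw [coeff_sum_monomial ha] at hcoeff
  exact isPrime_augIdeal.mem_of_pow_mem _ (germIdeal_le hcoeff)

/-- By Nakayama, generation modulo `J` lifts to generation of `H` over its `p ^ M`-th powers near
the identity, so a relation modulo `J` becomes a relation with `p ^ M`-th power coefficients. -/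
theorem IsAdapted.linearIndepOn_mkₐ_augFrobPow [Algebra.FiniteType k H] (hA : IsAdapted k p x e)
    {M : ℕ} (he : ∀ i, e i ≤ M)
    (hspan : ∀ h, ∃ c : (ι →₀ ℕ) → k,
      h - ∑ a ∈ exponentBox (fun i => p ^ e i), c a • ∏ i, x i ^ a i ∈ augFrobPow k p H M) :
    LinearIndepOn k (fun a : ι →₀ ℕ => ∏ i, Ideal.Quotient.mkₐ k (augFrobPow k p H M) (x i) ^ a i)
      (exponentBox fun i => p ^ e i) := by
  have : PerfectRing k p := PerfectField.toPerfectRing p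
  let box := exponentBox fun i => p ^ e i
  let F := iterateFrobenius H p M
  choose r hr using (iterateFrobeniusEquiv k p M).surjective
  have hFr (c : k) : F (algebraMap k H (r c)) = algebraMap k H c := by
    rw [iterateFrobenius_def, ← map_pow, ← iterateFrobeniusEquiv_def, hr]
  obtain ⟨s, hs, hspan⟩ := exists_sub_one_mem_forall_mul_eq_sum (I := augIdeal k H) (s := box)
    (iterateFrobenius_finite k p H M) (y := fun a => ∏ i, x i ^ a i) fun h => by
      obtain ⟨c, hc⟩ := hspan h
      exact ⟨fun a => algebraMap k H (r (c a)), by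
        simpa only [F, hFr, ← Algebra.smul_def] using hc⟩
  refine linearIndepOn_finset_iff.2 fun c hc a ha => ?_
  have hmem : ∑ a ∈ box, c a • ∏ i, x i ^ a i ∈ augFrobPow k p H M :=
    Ideal.Quotient.eq_zero_iff_mem.1 <| by
      simpa only [← Ideal.Quotient.mkₐ_eq_mk k, map_sum, map_smul, map_prod, map_pow] using hc
  obtain ⟨d, hd, hsum⟩ := hspan _ hmem
  let f (a : ι →₀ ℕ) : H := s * algebraMap k H (r (c a)) - d a
  have hf : f a ∈ augIdeal k H := by
    refine hA.mem_augIdeal_of_sum_eq_zero he ?_ ha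
    rw [← sub_eq_zero.2 hsum, Finset.mul_sum, ← Finset.sum_sub_distrib]
    refine Finset.sum_congr rfl fun a _ => ?_
    rw [← iterateFrobenius_def, map_sub, map_mul, hFr, Algebra.smul_def, sub_mul, mul_assoc]
  have hcounit : r (c a) = 0 := by
    have hs : Coalgebra.counit (R := k) s = 1 := by
      simpa [RingHom.mem_ker, sub_eq_zero] using hs
    have hda : Coalgebra.counit (R := k) (d a) = 0 := hd a
    simpa [f, RingHom.mem_ker, hs, hda] using hf
  rw [← hr (c a), hcounit, map_zero]

theorem IsAdapted.isTruncatedPolynomial [Algebra.FiniteType k H] (hA : IsAdapted k p x e)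
    (hgen : augIdeal k H ≤ Ideal.span (Set.range x) ⊔ augIdeal k H ^ 2) {M : ℕ}
    (he : ∀ i, e i ≤ M) (hx : ∀ i, x i ^ p ^ e i ∈ augFrobPow k p H M) :
    IsTruncatedPolynomial k (fun i => Ideal.Quotient.mkₐ k (augFrobPow k p H M) (x i))
      fun i => p ^ e i := by
  have : IsNoetherianRing H := Algebra.FiniteType.isNoetherianRing k H
  obtain ⟨n, hn⟩ := exists_augIdeal_pow_le_augFrobPow (k := k) (p := p) (H := H) M
  have hpow (i : ι) : Ideal.Quotient.mkₐ k (augFrobPow k p H M) (x i) ^ p ^ e i = 0 := by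
    rw [← map_pow]
    exact Ideal.Quotient.eq_zero_iff_mem.2 (hx i)
  have hsurj := aeval_mkₐ_surjective (k := k)
    (fun y => ⟨Coalgebra.counit y, sub_algebraMap_counit_mem_augIdeal y⟩) hA.mem_augIdeal hgen hn
  refine ⟨hpow, hsurj, hA.linearIndepOn_mkₐ_augFrobPow he fun h => ?_⟩
  obtain ⟨P, hP⟩ := hsurj (Ideal.Quotient.mkₐ k _ h)
  refine ⟨P.coeff, Ideal.Quotient.eq_zero_iff_mem.1 ?_⟩
  rw [aeval_eq_sum_exponentBox hpow, Ideal.Quotient.mkₐ_eq_mk] at hP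
  rw [map_sub, ← hP, sub_eq_zero]
  simp only [← Ideal.Quotient.mkₐ_eq_mk k, map_sum, map_smul, map_prod, map_pow]

end FrobeniusPower

section Flag

variable {k V V' V'' : Type*} [Field k] [AddCommGroup V] [Module k V] [AddCommGroup V']
  [Module k V'] [AddCommGroup V''] [Module k V''] {q : V →ₗ[k] V'}

theorem exists_linearIndepOn_flag {W : ℕ → Submodule k V} (hW : Monotone W)
    (h0 : (W 0).map q = ⊥) (M : ℕ) {N : Submodule k V} (hN : W M ≤ N) :
    ∃ B ⊆ (N : Set V), LinearIndepOn k q B ∧ N.map q ≤ Submodule.span k (q '' B) ∧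
      ∀ s ≤ M, (W s).map q ≤ Submodule.span k (q '' (B ∩ W s)) := by
  have hextend {B : Set V} {N : Submodule k V} (hB : LinearIndepOn k q B) (hBN : B ⊆ N) :
      N.map q ≤ Submodule.span k (q '' hB.extend hBN) := by
    rw [hB.span_image_extend_eq_span_image, ← Submodule.map_span, Submodule.span_eq]
  induction M generalizing N with
  | zero =>
    refine ⟨_, (linearIndepOn_empty k q).extend_subset (Set.empty_subset N),
      LinearIndepOn.linearIndepOn_extend _ _, hextend _ _, fun s hs => ?_⟩
    rw [Nat.le_zero.1 hs, h0]
    exact bot_le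
  | succ M ih =>
    obtain ⟨B, hBW, hB, hspan, hflag⟩ := ih (hW M.le_succ)
    have hBN : B ⊆ N := hBW.trans hN
    have hmono (s : ℕ) : q '' (B ∩ W s) ⊆ q '' (hB.extend hBN ∩ W s) :=
      Set.image_mono (Set.inter_subset_inter_left _ (hB.subset_extend hBN))
    refine ⟨_, hB.extend_subset hBN, hB.linearIndepOn_extend hBN, hextend hB hBN, fun s hs => ?_⟩
    refine le_trans ?_ (Submodule.span_mono (hmono s))
    rcases Nat.le_succ_iff.1 hs with hs | rfl
    · exact hflag s hs
    · rwa [Set.inter_eq_left.2 hBW]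

theorem linearIndepOn_sdiff_of_ker_le {B : Set V} (hB : LinearIndepOn k q B) {W : Submodule k V}
    (hW : W.map q ≤ Submodule.span k (q '' (B ∩ W))) {g : V →ₗ[k] V''}
    (hg : LinearMap.ker g ≤ LinearMap.ker q ⊔ W) : LinearIndepOn k g (B \ W) := by
  rw [← Set.inter_union_sdiff B W,
    linearIndepOn_union_iff_quotient Set.disjoint_sdiff_inter.symm] at hB
  refine linearIndependent_of_ker_le
    (f := (Submodule.span k (q '' (B ∩ W))).mkQ ∘ₗ q) (hg.trans (sup_le ?_ ?_)) hB.2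
  · exact LinearMap.ker_le_ker_comp _ _
  · rwa [LinearMap.ker_comp, Submodule.ker_mkQ, ← Submodule.map_le_iff_le_comap]

end Flag

section Parameters

variable {k : Type*} [Field k] {p : ℕ} [Fact p.Prime] {H : Type*} [CommRing H]

theorem ker_iterateFrobenius_mono [CharP H p] :
    Monotone fun s => RingHom.ker (iterateFrobenius H p s) := by
  intro s t hst x hx
  rw [RingHom.mem_ker, iterateFrobenius_def] at hx ⊢
  exact pow_eq_zero_of_le (Nat.pow_le_pow_right (Fact.out : p.Prime).pos hst) hx

theorem ker_iterateFrobenius_le_nilradical [CharP H p] (s : ℕ) :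
    RingHom.ker (iterateFrobenius H p s) ≤ nilradical H :=
  fun _ hy => mem_nilradical.2 ⟨p ^ s, hy⟩

theorem exists_ker_iterateFrobenius_eq_nilradical [IsNoetherianRing H] [CharP H p] :
    ∃ M, RingHom.ker (iterateFrobenius H p M) = nilradical H := by
  obtain ⟨n, hn⟩ := IsNoetherianRing.isNilpotent_nilradical H
  refine ⟨n, (ker_iterateFrobenius_le_nilradical n).antisymm fun y hy => ?_⟩
  have hyn : y ^ n ∈ nilradical H ^ n := Ideal.pow_mem_pow hy n
  rw [hn] at hyn
  exact pow_eq_zero_of_le (Nat.lt_pow_self (Fact.out : p.Prime).one_lt).le hyn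

variable [Bialgebra k H]

theorem finite_quotient_augIdeal_sq [IsNoetherianRing H] :
    Module.Finite k (H ⧸ augIdeal k H ^ 2) := by
  obtain ⟨n, x, hx⟩ := Submodule.fg_iff_exists_fin_generating_family.1
    (IsNoetherian.noetherian (augIdeal k H))
  have hmem (i : Fin n) : x i ∈ augIdeal k H := hx ▸ Submodule.subset_span ⟨i, rfl⟩
  refine finite_of_aeval_surjective (N := fun _ => 2) (fun i => ?_)
    (aeval_mkₐ_surjective (k := k) (m := augIdeal k H)
      (fun y => ⟨Coalgebra.counit y, sub_algebraMap_counit_mem_augIdeal y⟩) hmem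
      (hx.ge.trans le_sup_left) le_rfl)
  rw [← map_pow]
  exact Ideal.Quotient.eq_zero_iff_mem.2 (Ideal.pow_mem_pow (hmem i) 2)

/-- Elements `u` and `t` spanning the cotangent space of `H` at the identity, with the `t j`
nilpotent of exact exponents `p ^ e j` and the `u i` parameters of the reduced quotient. The number
`M` bounds the exponents of all nilpotents. -/
structure IsParameterSystem (k : Type*) [Field k] (p : ℕ) [Fact p.Prime] {H : Type*} [CommRing H]
    [Bialgebra k H] [CharP H p] {κ ι : Type*} (M : ℕ) (u : κ → H) (t : ι → H) (e : ι → ℕ) :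
    Prop where
  ker_iterateFrobenius_eq : RingHom.ker (iterateFrobenius H p M) = nilradical H
  exponent_pos : ∀ j, 0 < e j
  exponent_le : ∀ j, e j ≤ M
  pow_eq_zero : ∀ j, t j ^ p ^ e j = 0
  augIdeal_le : augIdeal k H ≤ Ideal.span (Set.range (Sum.elim u t)) ⊔ augIdeal k H ^ 2
  isAdapted : ∀ M', IsAdapted k p (Sum.elim u t) (Sum.elim (fun _ => M') e)

theorem exists_flag_basis [IsNoetherianRing H] [CharP H p] {M : ℕ}
    (hM : RingHom.ker (iterateFrobenius H p M) = nilradical H) :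
    ∃ B : Set H, B.Finite ∧ B ⊆ augIdeal k H ∧ 0 ∉ B ∧
      augIdeal k H ≤ Ideal.span B ⊔ augIdeal k H ^ 2 ∧
      ∀ s, LinearIndepOn k
        (Ideal.Quotient.mkₐ k (augIdeal k H ^ 2 ⊔ RingHom.ker (iterateFrobenius H p s)))
        (B \ RingHom.ker (iterateFrobenius H p s)) := by
  let m := augIdeal k H
  let q := (Ideal.Quotient.mkₐ k (m ^ 2)).toLinearMap
  let W (s : ℕ) : Submodule k H := (RingHom.ker (iterateFrobenius H p s)).restrictScalars k
  have hW0 : (W 0).map q = ⊥ := by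
    rw [eq_bot_iff]
    rintro _ ⟨y, hy, rfl⟩
    have hy : y ^ p ^ 0 = 0 := hy
    simp_all
  have hnil : nilradical H ≤ m := by
    rw [nilradical_eq_sInf]
    exact sInf_le isPrime_augIdeal
  obtain ⟨B, hBm, hB, hspan, hflag⟩ := exists_linearIndepOn_flag (W := W) (q := q)
    (fun s t hst => ker_iterateFrobenius_mono hst) hW0 M (N := m.restrictScalars k)
    (hM.trans_le hnil)
  have hfin := finite_quotient_augIdeal_sq (k := k) (H := H)
  refine ⟨B, hB.linearIndependent.finite, hBm, fun h => hB.ne_zero h (map_zero q),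
    fun y hy => ?_, fun s => ?_⟩
  · have hqy := hspan (Submodule.mem_map_of_mem hy)
    rw [← Submodule.map_span] at hqy
    obtain ⟨z, hz, hzy⟩ := hqy
    rw [← add_sub_cancel z y]
    refine Submodule.add_mem_sup (Submodule.span_le_restrictScalars k H B hz) ?_
    exact Ideal.Quotient.eq.1 hzy.symm
  · have hker : RingHom.ker (iterateFrobenius H p s) =
        RingHom.ker (iterateFrobenius H p (min s M)) := by
      rcases le_total s M with hs | hs
      · rw [min_eq_left hs]
      · rw [min_eq_right hs]
        exact ((ker_iterateFrobenius_le_nilradical s).trans_eq hM.symm).antisymm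
          (ker_iterateFrobenius_mono hs)
    rw [hker]
    refine linearIndepOn_sdiff_of_ker_le hB (hflag _ (min_le_right s M))
      (g := (Ideal.Quotient.mkₐ k _).toLinearMap) fun y hy => ?_
    obtain ⟨a, ha, b, hb, rfl⟩ := Submodule.mem_sup.1 (Ideal.Quotient.eq_zero_iff_mem.1 hy)
    exact Submodule.add_mem_sup (Ideal.Quotient.eq_zero_iff_mem.2 ha) hb

theorem exists_isParameterSystem [IsNoetherianRing H] [CharP H p] :
    ∃ (M r n : ℕ) (u : Fin r → H) (t : Fin n → H) (e : Fin n → ℕ),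
      IsParameterSystem k p M u t e := by
  classical
  obtain ⟨M, hM⟩ := exists_ker_iterateFrobenius_eq_nilradical (p := p) (H := H)
  obtain ⟨B, hfin, hBm, hB0, hgen, hB⟩ := exists_flag_basis (k := k) hM
  obtain ⟨r, u, hu, hur⟩ := (hfin.sdiff (t := (nilradical H : Set H))).fin_param
  obtain ⟨n, t, ht, htr⟩ := (hfin.inter_of_left (nilradical H : Set H)).fin_param
  have hrange : Set.range (Sum.elim u t) = B := by
    rw [Set.Sum.elim_range, hur, htr, Set.sdiff_union_inter]
  have hmem (i : Fin r ⊕ Fin n) : Sum.elim u t i ∈ B := hrange ▸ Set.mem_range_self i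
  have hu_nil (i : Fin r) : u i ∉ nilradical H := (hur ▸ Set.mem_range_self i : u i ∈ B \ _).2
  have ht_nil (j : Fin n) : t j ∈ nilradical H := (htr ▸ Set.mem_range_self j : t j ∈ B ∩ _).2
  have ht_pow (j : Fin n) : t j ^ p ^ M = 0 := hM.ge (ht_nil j)
  have hinj : Function.Injective (Sum.elim u t) :=
    hu.sumElim ht fun i j h => hu_nil i (h ▸ ht_nil j)
  have hex (j : Fin n) : ∃ s, t j ^ p ^ s = 0 := ⟨M, ht_pow j⟩
  let e (j : Fin n) : ℕ := Nat.find (hex j)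
  have he (j : Fin n) : t j ^ p ^ e j = 0 := Nat.find_spec (hex j)
  have hflag (M' s : ℕ) (i : {i // s < Sum.elim (fun _ => M') e i}) :
      Sum.elim u t i.1 ∈ B \ RingHom.ker (iterateFrobenius H p s) := by
    refine ⟨hmem i, ?_⟩
    obtain ⟨i | j, hs⟩ := i
    · exact fun h => hu_nil i (ker_iterateFrobenius_le_nilradical s h)
    · exact Nat.find_min (hex j) hs
  refine ⟨M, r, n, u, t, e, hM, fun j => Nat.pos_of_ne_zero fun h0 => ?_,
    fun j => Nat.find_min' (hex j) (ht_pow j), he, hrange ▸ hgen, fun M' => ⟨fun i => hBm (hmem i),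
      fun s => (hB s).linearIndependent.comp (fun i => ⟨_, hflag M' s i⟩)
        fun i j h => Subtype.ext (hinj (Subtype.mk_eq_mk.1 h))⟩⟩
  have htj := he j
  rw [h0, pow_zero, pow_one] at htj
  exact hB0 (htj ▸ hmem (Sum.inr j))

end Parameters

section Comparison

open Algebra.TensorProduct

theorem productMap_id_antipode_comp_comul {k K : Type*} [Field k] [CommRing K] [HopfAlgebra k K] :
    (productMap (AlgHom.id k K) (HopfAlgebra.antipodeAlgHom k K)).comp
      (Bialgebra.comulAlgHom k K) = (Algebra.ofId k K).comp (Bialgebra.counitAlgHom k K) := by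
  ext x
  rw [productMap_eq_comp_map]
  exact HopfAlgebra.mul_antipode_lTensor_comul_apply x

namespace ComoduleAlgebra

variable {k K A B : Type*} [Field k] [CommRing K] [CommRing A] [Algebra k A] [CommRing B]
  [Algebra k B]

section Bialgebra

variable [Bialgebra k K] (ρ : ComoduleAlgebra k K A) (f : A →ₐ[k] B)

/-- The map `a ↦ f (a₍₀₎) ⊗ a₍₁₎`, the unique colinear algebra map to the cofree comodule algebra
`B ⊗ K` which lifts `f`. -/
noncomputable def comparison : A →ₐ[k] B ⊗[k] K := (map f (AlgHom.id k K)).comp ρ.coact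

theorem comparison_colinear (a : A) :
    (tensor B).coact (ρ.comparison f a) =
      map (ρ.comparison f) (AlgHom.id k K) (ρ.coact a) := by
  have hassoc : (Algebra.TensorProduct.assoc k k k B K K).symm.toAlgHom.comp
      ((map f (AlgHom.id k (K ⊗[k] K))).comp (Algebra.TensorProduct.assoc k k k A K K).toAlgHom) =
      map (map f (AlgHom.id k K)) (AlgHom.id k K) := by
    ext <;> simp [one_def]
  have hcomp : (map (map f (AlgHom.id k K)) (AlgHom.id k K)).comp (map ρ.coact (AlgHom.id k K)) =
      map (ρ.comparison f) (AlgHom.id k K) := by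
    ext <;> rfl
  suffices (tensor B).coact.comp (ρ.comparison f) =
      (map (ρ.comparison f) (AlgHom.id k K)).comp ρ.coact from DFunLike.congr_fun this a
  calc
    _ = (Algebra.TensorProduct.assoc k k k B K K).symm.toAlgHom.comp
        (((map (AlgHom.id k B) (Bialgebra.comulAlgHom k K)).comp
          (map f (AlgHom.id k K))).comp ρ.coact) := rfl
    _ = (Algebra.TensorProduct.assoc k k k B K K).symm.toAlgHom.comp
        ((map f (AlgHom.id k (K ⊗[k] K))).comp
          ((map (AlgHom.id k A) (Bialgebra.comulAlgHom k K)).comp ρ.coact)) := by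
      rw [← map_comp, ← AlgHom.comp_assoc (map f _), ← map_comp]
      rfl
    _ = (map (map f (AlgHom.id k K)) (AlgHom.id k K)).comp
        ((map ρ.coact (AlgHom.id k K)).comp ρ.coact) := by
      rw [← ρ.coassoc, ← hassoc]
      rfl
    _ = _ := by rw [← AlgHom.comp_assoc, hcomp]

variable {f} in
theorem comp_comparison_congr {C : Type*} [CommRing C] [Algebra k C] {q : B ⊗[k] K →ₐ[k] C}
    {g : A →ₐ[k] B} (h : (q.comp includeLeft).comp f = (q.comp includeLeft).comp g) :
    q.comp (ρ.comparison f) = q.comp (ρ.comparison g) := by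
  have hmap : q.comp (map f (AlgHom.id k K)) = q.comp (map g (AlgHom.id k K)) := by
    refine Algebra.TensorProduct.ext ?_ (by ext; simp)
    rw [AlgHom.comp_assoc, AlgHom.comp_assoc, map_comp_includeLeft, map_comp_includeLeft]
    exact h
  exact congrArg (AlgHom.comp · ρ.coact) hmap

/-- An ideal `I` of a comodule algebra is a subcomodule if its coaction takes values in `I ⊗ K`. -/
def IsSubcomodule (I : Ideal A) : Prop :=
  I ≤ (I.map (includeLeft : A →ₐ[k] A ⊗[k] K)).comap ρ.coact

variable {ρ}

theorem isSubcomodule_ker {g : A →ₐ[k] B} (hg : Function.Surjective g)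
    (h : ∀ a, g a = 0 → map g (AlgHom.id k K) (ρ.coact a) = 0) :
    ρ.IsSubcomodule (RingHom.ker g) := by
  intro a ha
  rw [Ideal.mem_comap, ← rTensor_ker g hg]
  exact h a ha

end Bialgebra

section Hopf

variable [HopfAlgebra k K] (ρ : ComoduleAlgebra k K A)

/-- The map `a ⊗ x ↦ a₍₀₎ ⊗ a₍₁₎ S(x)`, which undoes the coaction. -/
noncomputable def shear : A ⊗[k] K →ₐ[k] A ⊗[k] K :=
  productMap ρ.coact (includeRight.comp (HopfAlgebra.antipodeAlgHom k K))

theorem shear_comp_includeLeft : ρ.shear.comp includeLeft = ρ.coact :=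
  productMap_left _ _

theorem shear_comp_coact : ρ.shear.comp ρ.coact = includeLeft := by
  have hinclude : (map (AlgHom.id k A) (productMap (AlgHom.id k K)
      (HopfAlgebra.antipodeAlgHom k K))).comp
      ((Algebra.TensorProduct.assoc k k k A K K).toAlgHom.comp includeLeft) =
      AlgHom.id k (A ⊗[k] K) := by
    ext <;> simp
  have hshear : ρ.shear = (map (AlgHom.id k A) (productMap (AlgHom.id k K)
      (HopfAlgebra.antipodeAlgHom k K))).comp
      ((Algebra.TensorProduct.assoc k k k A K K).toAlgHom.comp
        (map ρ.coact (AlgHom.id k K))) := by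
    ext x
    · simpa [shear] using (DFunLike.congr_fun hinclude (ρ.coact x)).symm
    · simp [shear, one_def]
  rw [hshear, AlgHom.comp_assoc, AlgHom.comp_assoc, ρ.coassoc, ← AlgHom.comp_assoc, ← map_comp,
    productMap_id_antipode_comp_comul, AlgHom.id_comp, map_id_comp, AlgHom.comp_assoc, ρ.counital]
  ext
  simp

variable {ρ} {I : Ideal A}

theorem IsSubcomodule.map_includeLeft_le (hI : ρ.IsSubcomodule I) (f : A →ₐ[k] B) :
    (I.map f).map (includeLeft : B →ₐ[k] B ⊗[k] K) ≤ I.map (ρ.comparison f) := by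
  let g : A ⊗[k] K →ₐ[k] B ⊗[k] K := (map f (AlgHom.id k K)).comp ρ.shear
  have hleft : g.comp includeLeft = ρ.comparison f := by
    rw [AlgHom.comp_assoc, shear_comp_includeLeft, comparison]
  have hcoact : g.comp ρ.coact = includeLeft.comp f := by
    rw [AlgHom.comp_assoc, shear_comp_coact, map_comp_includeLeft]
  calc
    _ = (I.map ρ.coact).map g := by rw [Ideal.map_mapₐ, Ideal.map_mapₐ, hcoact]
    _ ≤ (I.map (includeLeft : A →ₐ[k] A ⊗[k] K)).map g :=
      Ideal.map_mono (Ideal.map_le_iff_le_comap.2 hI)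
    _ = _ := by rw [Ideal.map_mapₐ, hleft]

theorem IsSubcomodule.smul_coact_eq_zero (hI : ρ.IsSubcomodule I) {c : A}
    (hc : ∀ a ∈ I, c * a = 0) {a : A} (ha : a ∈ I) : a • ρ.coact c = 0 := by
  have hmem := hI.map_includeLeft_le (AlgHom.id k A)
    (Ideal.mem_map_of_mem _ (Ideal.mem_map_of_mem _ ha))
  have hann : I.map (ρ.comparison (AlgHom.id k A)) ≤
      Submodule.annihilator (Ideal.span {ρ.coact c}) := by
    refine Ideal.map_le_iff_le_comap.2 fun b hb =>
      (Submodule.mem_annihilator_span_singleton _ _).2 ?_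
    rw [comparison, map_id, AlgHom.id_comp, smul_eq_mul, ← map_mul, mul_comm, hc b hb, map_zero]
  exact (algebraMap_smul (A ⊗[k] K) a (ρ.coact c)).symm.trans
    ((Submodule.mem_annihilator_span_singleton _ _).1 (hann hmem))

end Hopf

section OfBialgHom

variable {H : Type*} [CommRing H] [Bialgebra k H]

theorem map_coact_ofBialgHom [Bialgebra k K] (π : H →ₐc[k] K) (h : H) :
    map (π : H →ₐ[k] K) (AlgHom.id k K) ((ofBialgHom π).coact h) = Coalgebra.comul (π h) := by
  rw [← CoalgHomClass.map_comp_comul_apply π h]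
  have hmap : (map (π : H →ₐ[k] K) (AlgHom.id k K)).comp (map (AlgHom.id k H) (π : H →ₐ[k] K)) =
      map (π : H →ₐ[k] K) (π : H →ₐ[k] K) := by
    rw [← map_comp, AlgHom.comp_id, AlgHom.id_comp]
  exact DFunLike.congr_fun hmap (Coalgebra.comul h)

theorem comparison_ofBialgHom_counit [Bialgebra k K] (π : H →ₐc[k] K) :
    (ofBialgHom π).comparison ((Algebra.ofId k B).comp (Bialgebra.counitAlgHom k H)) =
      includeRight.comp (π : H →ₐ[k] K) := by
  have hmap : (map (Algebra.ofId k B) (π : H →ₐ[k] K)).comp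
      (Algebra.TensorProduct.lid k H).symm.toAlgHom = includeRight.comp (π : H →ₐ[k] K) := by
    ext
    simp
  have hcounit : (map (Bialgebra.counitAlgHom k H) (AlgHom.id k H)).comp
      (Bialgebra.comulAlgHom k H) = (Algebra.TensorProduct.lid k H).symm.toAlgHom :=
    AlgHom.ext Coalgebra.rTensor_counit_comul
  rw [← hmap, ← hcounit, ← AlgHom.comp_assoc, ← map_comp, comparison, ofBialgHom,
    ← AlgHom.comp_assoc, ← map_comp, AlgHom.comp_id, AlgHom.comp_id, AlgHom.id_comp]

variable [HopfAlgebra k K] {π : H →ₐc[k] K}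

theorem isSubcomodule_ker_ofBialgHom (hπ : Function.Surjective π) :
    (ofBialgHom π).IsSubcomodule (RingHom.ker (π : H →ₐ[k] K)) :=
  isSubcomodule_ker hπ fun h (hh : π h = 0) => by
    rw [map_coact_ofBialgHom, hh, map_zero]

variable {f : H →ₐ[k] B}

theorem comparison_ofBialgHom_surjective (hπ : Function.Surjective π)
    (hnil : IsNilpotent (RingHom.ker (π : H →ₐ[k] K))) (hf : Function.Surjective f)
    (haug : (augIdeal k H).map f ≤ (RingHom.ker (π : H →ₐ[k] K)).map f) :
    Function.Surjective ((ofBialgHom π).comparison f) := by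
  let θ := (ofBialgHom π).comparison f
  let J := (RingHom.ker (π : H →ₐ[k] K)).map θ
  let q := Ideal.Quotient.mkₐ k J
  have hqf : (q.comp includeLeft).comp f =
      (q.comp includeLeft).comp ((Algebra.ofId k B).comp (Bialgebra.counitAlgHom k H)) := by
    ext h
    refine Ideal.Quotient.eq.2 ?_
    rw [← map_sub]
    refine (isSubcomodule_ker_ofBialgHom hπ).map_includeLeft_le f
      (Ideal.mem_map_of_mem _ (haug ?_))
    have := Ideal.mem_map_of_mem f (sub_algebraMap_counit_mem_augIdeal (k := k) h)
    rwa [map_sub, AlgHom.commutes] at this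
  have hqθ : q.comp θ = (q.comp includeRight).comp (π : H →ₐ[k] K) := by
    rw [AlgHom.comp_assoc, ← comparison_ofBialgHom_counit]
    exact comp_comparison_congr _ hqf
  have hrange (z : B ⊗[k] K) : q z ∈ (q.comp θ).range := by
    induction z with
    | zero => exact zero_mem _
    | add z w hz hw => exact add_mem hz hw
    | tmul b x =>
      obtain ⟨h, rfl⟩ := hf b
      obtain ⟨y, rfl⟩ := hπ x
      rw [← mul_one (f h), ← one_mul (π y), ← tmul_mul_tmul, map_mul]
      have hqh : q (f h ⊗ₜ 1) = algebraMap k _ (Coalgebra.counit h) :=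
        (DFunLike.congr_fun hqf h).trans (AlgHom.commutes (q.comp includeLeft) _)
      exact mul_mem (hqh ▸ algebraMap_mem _ _) ⟨y, DFunLike.congr_fun hqθ y⟩
  refine surjective_of_isNilpotent_map (φ := (θ : H →+* B ⊗[k] K)) (hnil.map (Ideal.mapHom _))
    fun z => ?_
  obtain ⟨h, hh⟩ := hrange z
  exact ⟨h, Ideal.Quotient.eq.1 hh.symm⟩

theorem exists_linearMap_isUnit_coact (hπ : Function.Surjective π)
    (hnil : IsNilpotent (RingHom.ker (π : H →ₐ[k] K))) {c : H}
    (hc : Coalgebra.counit (R := k) c = 1) :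
    ∃ μ : H ⊗[k] K →ₗ[H] H, IsUnit (μ ((ofBialgHom π).coact c)) := by
  obtain ⟨σ, hσ⟩ := (π : H →ₗ[k] K).exists_rightInverse_of_surjective
    (LinearMap.range_eq_top.2 hπ)
  replace hσ (x : K) : π (σ x) = x := DFunLike.congr_fun hσ x
  let μ : H ⊗[k] K →ₗ[H] H := (σ ∘ₗ HopfAlgebraStruct.antipode k).liftBaseChange H
  have hμ (z : H ⊗[k] K) : π (μ z) = productMap (AlgHom.id k K)
      (HopfAlgebra.antipodeAlgHom k K) (map (π : H →ₐ[k] K) (AlgHom.id k K) z) := by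
    induction z with
    | zero => simp only [map_zero]
    | add z w hz hw => simp only [map_add, hz, hw]
    | tmul h x => simp [μ, hσ]
  have hπ_one : π (μ ((ofBialgHom π).coact c)) = 1 := by
    rw [hμ, map_coact_ofBialgHom]
    refine (DFunLike.congr_fun productMap_id_antipode_comp_comul (π c)).trans ?_
    refine (congrArg (algebraMap k K) (CoalgHomClass.counit_comp_apply π c)).trans ?_
    rw [hc, map_one]
  have hmem : 1 - μ ((ofBialgHom π).coact c) ∈ RingHom.ker (π : H →ₐ[k] K) :=
    (RingHom.sub_mem_ker_iff _).2 ((map_one π).trans hπ_one.symm)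
  obtain ⟨n, hn⟩ := hnil
  have hpow := Ideal.pow_mem_pow hmem n
  rw [hn] at hpow
  exact ⟨μ, by simpa using IsNilpotent.isUnit_one_sub ⟨n, hpow⟩⟩

theorem comparison_ofBialgHom_injective (hπ : Function.Surjective π)
    (hnil : IsNilpotent (RingHom.ker (π : H →ₐ[k] K)))
    (hsurj : Function.Surjective ((ofBialgHom π).comparison f)) {c : H}
    (hc : Coalgebra.counit (R := k) c = 1)
    (hker : ∀ l ∈ RingHom.ker ((ofBialgHom π).comparison f), c * l = 0) :
    Function.Injective ((ofBialgHom π).comparison f) := by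
  obtain ⟨μ, hμ⟩ := exists_linearMap_isUnit_coact hπ hnil hc
  have hsub : (ofBialgHom π).IsSubcomodule (RingHom.ker ((ofBialgHom π).comparison f)) :=
    isSubcomodule_ker hsurj fun l hl => by rw [← comparison_colinear, hl, map_zero]
  rw [injective_iff_map_eq_zero]
  intro l hl
  rw [← hμ.mul_left_eq_zero, ← smul_eq_mul, ← map_smul, hsub.smul_coact_eq_zero hker hl,
    map_zero]

end OfBialgHom

end ComoduleAlgebra

end Comparison

section ComparisonKernel

open Algebra.TensorProduct ComoduleAlgebra

variable {k : Type*} [Field k] {p : ℕ} [Fact p.Prime]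

theorem exists_sub_one_mem_forall_mul_eq_zero {R : Type*} [CommRing R] [IsNoetherianRing R]
    {I L : Ideal R} (hL : ∀ n, L ≤ I ^ n) : ∃ c, c - 1 ∈ I ∧ ∀ l ∈ L, c * l = 0 := by
  refine Submodule.exists_sub_one_mem_and_smul_eq_zero_of_fg_of_le_smul I L
    (IsNoetherian.noetherian L) fun l hl => ?_
  have hmem : l ∈ (⨅ n : ℕ, I ^ n • ⊤ : Submodule R R) := by
    simpa only [smul_eq_mul, Ideal.mul_top, Submodule.mem_iInf] using fun n => hL n hl
  obtain ⟨r, hr⟩ := (Ideal.mem_iInf_smul_pow_eq_bot_iff I l).1 hmem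
  exact hr ▸ Submodule.smul_mem_smul r.2 hl

theorem map_pow_char_pow_congr [CharP k p] {A B C : Type*} [CommRing A] [Algebra k A] [CommRing B]
    [Algebra k B] [CommRing C] [Algebra k C] {f g : A →ₐ[k] B} {M : ℕ}
    (h : ∀ a, f a ^ p ^ M = g a ^ p ^ M) (z : A ⊗[k] C) :
    map f (AlgHom.id k C) z ^ p ^ M = map g (AlgHom.id k C) z ^ p ^ M := by
  rcases subsingleton_or_nontrivial (B ⊗[k] C)
  · exact Subsingleton.elim _ _
  have : CharP (B ⊗[k] C) p :=
    charP_of_injective_algebraMap (algebraMap k (B ⊗[k] C)).injective p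
  induction z with
  | zero => rw [map_zero, map_zero]
  | add x y hx hy => rw [map_add, map_add, add_pow_char_pow, add_pow_char_pow, hx, hy]
  | tmul a c => rw [map_tmul, map_tmul, tmul_pow, tmul_pow, h]

variable {H K B : Type*} [CommRing H] [Bialgebra k H] [CommRing K] [CommRing B] [Algebra k B]
  {f : H →ₐ[k] B} {M : ℕ}

theorem augFrobPow_le_augIdeal_pow [CharP H p] (M : ℕ) :
    augFrobPow k p H M ≤ augIdeal k H ^ M :=
  Ideal.map_le_iff_le_comap.2 fun _ hx =>
    Ideal.pow_le_pow_right (Nat.lt_pow_self (Fact.out : p.Prime).one_lt).le (Ideal.pow_mem_pow hx _)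

theorem comparison_ofBialgHom_pow [CharP k p] [Bialgebra k K] (π : H →ₐc[k] K)
    (hf : ∀ x ∈ augIdeal k H, f x ^ p ^ M = 0) (x : H) :
    (ofBialgHom π).comparison f x ^ p ^ M = 1 ⊗ₜ (π x ^ p ^ M) := by
  rcases subsingleton_or_nontrivial B with hB | hB
  · have : Subsingleton (B ⊗[k] K) := Algebra.subsingleton B _
    exact Subsingleton.elim _ _
  have : CharP B p := charP_of_injective_algebraMap (algebraMap k B).injective p
  have hcounit (h : H) : f h ^ p ^ M =
      ((Algebra.ofId k B).comp (Bialgebra.counitAlgHom k H)) h ^ p ^ M := by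
    have hsub := hf _ (sub_algebraMap_counit_mem_augIdeal h)
    rw [map_sub, sub_pow_char_pow, sub_eq_zero, AlgHom.commutes] at hsub
    exact hsub
  calc (ofBialgHom π).comparison f x ^ p ^ M
      = (ofBialgHom π).comparison
          ((Algebra.ofId k B).comp (Bialgebra.counitAlgHom k H)) x ^ p ^ M :=
        map_pow_char_pow_congr hcounit _
    _ = 1 ⊗ₜ (π x ^ p ^ M) := by
      rw [comparison_ofBialgHom_counit]
      exact (map_pow (includeRight : K →ₐ[k] B ⊗[k] K) _ _).symm

/-- Modulo `p ^ M`-th powers the comparison map becomes a surjection of finite-dimensional algebras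
of the same dimension. -/
theorem ker_comparison_ofBialgHom_le_augFrobPow [CharP k p] [Bialgebra k K] [CharP H p] [CharP K p]
    {π : H →ₐc[k] K} (hf : ∀ x ∈ augIdeal k H, f x ^ p ^ M = 0)
    (hsurj : Function.Surjective ((ofBialgHom π).comparison f))
    [Module.Finite k (H ⧸ augFrobPow k p H M)]
    (hrank : Module.finrank k (H ⧸ augFrobPow k p H M) =
      Module.finrank k B * Module.finrank k (K ⧸ augFrobPow k p K M)) :
    RingHom.ker ((ofBialgHom π).comparison f) ≤ augFrobPow k p H M := by
  let q : B ⊗[k] K →ₐ[k] B ⊗[k] (K ⧸ augFrobPow k p K M) :=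
    map (AlgHom.id k B) (Ideal.Quotient.mkₐ k (augFrobPow k p K M))
  have hq : Function.Surjective q :=
    TensorProduct.map_surjective Function.surjective_id (Ideal.Quotient.mkₐ_surjective k _)
  have hker : augFrobPow k p H M ≤ RingHom.ker (q.comp ((ofBialgHom π).comparison f)) := by
    refine Ideal.map_le_iff_le_comap.2 fun x hx => ?_
    have hπx : Ideal.Quotient.mkₐ k (augFrobPow k p K M) (π x ^ p ^ M) = 0 :=
      Ideal.Quotient.eq_zero_iff_mem.2 (pow_mem_augFrobPow ((comap_augIdeal π).ge hx) M)
    rw [Ideal.mem_comap, iterateFrobenius_def, RingHom.mem_ker, AlgHom.comp_apply, map_pow,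
      comparison_ofBialgHom_pow π hf, map_tmul, hπx, TensorProduct.tmul_zero]
  let ψ := Ideal.Quotient.liftₐ _ (q.comp ((ofBialgHom π).comparison f)) hker
  have hψ : Function.Surjective ψ.toLinearMap :=
    Ideal.Quotient.lift_surjective_of_surjective _ hker (hq.comp hsurj)
  have := Module.Finite.of_surjective ψ.toLinearMap hψ
  have hinj : Function.Injective ψ.toLinearMap :=
    (LinearMap.injective_iff_surjective_of_finrank_eq_finrank
      (hrank.trans Module.finrank_tensorProduct.symm)).2 hψ
  intro l hl
  refine Ideal.Quotient.eq_zero_iff_mem.1 (hinj ?_)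
  rw [map_zero]
  change q ((ofBialgHom π).comparison f l) = 0
  rw [RingHom.mem_ker.1 hl, map_zero]

end ComparisonKernel

section Splitting

open ComoduleAlgebra

variable {k H : Type*} [Field k] {p : ℕ} [Fact p.Prime] [CommRing H] [Bialgebra k H] [CharP H p]

namespace IsParameterSystem

section

variable {κ ι : Type*} {M : ℕ} {u : κ → H} {t : ι → H} {e : ι → ℕ}

theorem isAdapted_comp_of_ker_eq_nilradical (h : IsParameterSystem k p M u t e) {K : Type*}
    [CommRing K] [Bialgebra k K] [CharP K p] {π : H →ₐc[k] K} (hπ : Function.Surjective π)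
    (hker : RingHom.ker π = nilradical H) (M' : ℕ) : IsAdapted k p (π ∘ u) fun _ => M' where
  mem_augIdeal i := (comap_augIdeal π).ge ((h.isAdapted M).mem_augIdeal (.inl i))
  linearIndependent s := by
    have hcomap : (RingHom.ker (iterateFrobenius K p s)).comap π =
        RingHom.ker (iterateFrobenius H p M) := by
      ext y
      rw [h.ker_iterateFrobenius_eq, Ideal.mem_comap, RingHom.mem_ker, iterateFrobenius_def,
        ← map_pow, ← RingHom.mem_ker, hker, mem_nilradical, mem_nilradical,
        IsNilpotent.pow_iff_pos (pow_ne_zero _ (Fact.out : p.Prime).ne_zero)]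
    have hli := ((h.isAdapted (M + 1)).linearIndependent M).comp
      (fun i : {_i : κ // s < M'} => ⟨.inl i, M.lt_succ_self⟩)
      fun i j hij => Subtype.ext (Sum.inl_injective (Subtype.mk_eq_mk.1 hij))
    rw [← hcomap, ← comap_sq_augIdeal_sup hπ] at hli
    let J := augIdeal k K ^ 2 ⊔ RingHom.ker (iterateFrobenius K p s)
    exact linearIndependent_of_ker_le (f := (Ideal.Quotient.mkₐ k (J.comap π)).toLinearMap)
      (g := ((Ideal.Quotient.mkₐ k J).comp (π : H →ₐ[k] K)).toLinearMap)
      (fun y (hy : Ideal.Quotient.mk J (π y) = 0) =>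
        Ideal.Quotient.eq_zero_iff_mem.2 (Ideal.Quotient.eq_zero_iff_mem.1 hy :)) hli

variable [Fintype κ] [CharP k p] [PerfectField k] [Algebra.FiniteType k H]

theorem isTruncatedPolynomial [Fintype ι] (h : IsParameterSystem k p M u t e) {M' : ℕ}
    (hM : M ≤ M') :
    IsTruncatedPolynomial k (fun i => Ideal.Quotient.mkₐ k (augFrobPow k p H M') (Sum.elim u t i))
      fun i => p ^ Sum.elim (fun _ => M') e i := by
  refine (h.isAdapted M').isTruncatedPolynomial h.augIdeal_le ?_ ?_
  · rintro (i | j)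
    exacts [le_rfl, (h.exponent_le j).trans hM]
  · rintro (i | j)
    · exact pow_mem_augFrobPow ((h.isAdapted M').mem_augIdeal (.inl i)) M'
    · exact (h.pow_eq_zero j).symm ▸ Ideal.zero_mem _

theorem isTruncatedPolynomial_of_ker_eq_nilradical (h : IsParameterSystem k p M u t e)
    {K : Type*} [CommRing K] [Bialgebra k K] [CharP K p] {π : H →ₐc[k] K}
    (hπ : Function.Surjective π) (hker : RingHom.ker π = nilradical H) (M' : ℕ) :
    IsTruncatedPolynomial k (fun i => Ideal.Quotient.mkₐ k (augFrobPow k p K M') (π (u i)))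
      fun _ => p ^ M' := by
  have : Algebra.FiniteType k K := .of_surjective (π : H →ₐ[k] K) hπ
  have hadapted := h.isAdapted_comp_of_ker_eq_nilradical hπ hker M'
  refine hadapted.isTruncatedPolynomial ?_ (fun _ => le_rfl)
    fun i => pow_mem_augFrobPow (hadapted.mem_augIdeal i) M'
  rw [← map_augIdeal hπ, ← Ideal.map_pow]
  refine (Ideal.map_mono h.augIdeal_le).trans ?_
  rw [Ideal.map_sup, Ideal.map_span]
  refine sup_le_sup_right (Ideal.span_le.2 ?_) _
  rintro _ ⟨_, ⟨i | j, rfl⟩, rfl⟩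
  · exact Ideal.subset_span ⟨i, rfl⟩
  · have htj : π (t j) = 0 := hker.ge (mem_nilradical.2 ⟨_, h.pow_eq_zero j⟩)
    exact htj.symm ▸ Ideal.zero_mem _

end

variable [CharP k p] [PerfectField k] [Algebra.FiniteType k H] {r n M : ℕ} {u : Fin r → H}
  {t : Fin n → H} {e : Fin n → ℕ}

theorem exists_algHom_truncPoly (h : IsParameterSystem k p M u t e) :
    ∃ f : H →ₐ[k] TruncPoly k p e, (∀ i, f (u i) = 0) ∧ (∀ j, f (t j) = TruncPoly.gen k p e j) ∧
      (augFrobPow k p H M).map f = ⊥ := by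
  obtain ⟨g, hg⟩ := (h.isTruncatedPolynomial le_rfl).exists_algHom
    (z := Sum.elim 0 (TruncPoly.gen k p e)) <| by
      rintro (i | j)
      · exact zero_pow (pow_ne_zero _ (Fact.out : p.Prime).ne_zero)
      · exact (TruncPoly.isTruncatedPolynomial_gen k p e).pow_eq_zero j
  refine ⟨g.comp (Ideal.Quotient.mkₐ k _), fun i => hg (.inl i), fun j => hg (.inr j), ?_⟩
  rw [eq_bot_iff, Ideal.map_le_iff_le_comap]
  intro x hx
  have hmk : Ideal.Quotient.mkₐ k (augFrobPow k p H M) x = 0 := Ideal.Quotient.eq_zero_iff_mem.2 hx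
  rw [Ideal.mem_comap, AlgHom.comp_apply, hmk, map_zero]
  exact Ideal.zero_mem _

theorem exists_truncation (h : IsParameterSystem k p M u t e) :
    ∃ f : H →ₐ[k] TruncPoly k p e, Function.Surjective f ∧
      (∀ x ∈ augIdeal k H, f x ^ p ^ M = 0) ∧ (augIdeal k H).map f ≤ (nilradical H).map f := by
  have hnoeth : IsNoetherianRing H := Algebra.FiniteType.isNoetherianRing k H
  obtain ⟨f, hfu, hft, hfJ⟩ := h.exists_algHom_truncPoly
  refine ⟨f, fun z => ?_, fun x hx => ?_, ?_⟩
  · obtain ⟨P, rfl⟩ := (TruncPoly.isTruncatedPolynomial_gen k p e).aeval_surjective z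
    exact ⟨MvPolynomial.aeval t P, by rw [MvPolynomial.comp_aeval_apply, funext hft]⟩
  · rw [← map_pow]
    exact (Ideal.mem_bot.1 (hfJ ▸ Ideal.mem_map_of_mem f (pow_mem_augFrobPow hx M)) :)
  · obtain ⟨N, hN⟩ := exists_augIdeal_pow_le_augFrobPow (k := k) (p := p) (H := H) M
    have hpow : (augIdeal k H).map f ^ N = ⊥ := by
      rw [← Ideal.map_pow, eq_bot_iff, ← hfJ]
      exact Ideal.map_mono hN
    have hle : (augIdeal k H).map f ≤
        (nilradical H).map f ⊔ (augIdeal k H).map f • (augIdeal k H).map f := by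
      rw [smul_eq_mul, ← Ideal.map_mul, ← pow_two]
      refine (Ideal.map_mono h.augIdeal_le).trans ?_
      rw [Ideal.map_sup, Ideal.map_span]
      refine sup_le_sup_right (Ideal.span_le.2 ?_) _
      rintro _ ⟨_, ⟨i | j, rfl⟩, rfl⟩
      · exact (hfu i).symm ▸ Ideal.zero_mem _
      · exact Ideal.mem_map_of_mem f (mem_nilradical.2 ⟨_, h.pow_eq_zero j⟩)
    simpa [hpow] using le_sup_pow_smul hle N

theorem ker_comparison_le_augFrobPow (h : IsParameterSystem k p M u t e) {K : Type*} [CommRing K]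
    [Bialgebra k K] {π : H →ₐc[k] K} (hπ : Function.Surjective π)
    (hker : RingHom.ker π = nilradical H) {f : H →ₐ[k] TruncPoly k p e} {M' : ℕ}
    (hf : ∀ x ∈ augIdeal k H, f x ^ p ^ M' = 0)
    (hsurj : Function.Surjective ((ofBialgHom π).comparison f)) (hM : M ≤ M') :
    RingHom.ker ((ofBialgHom π).comparison f) ≤ augFrobPow k p H M' := by
  have : CharP K p := charP_of_bialgebra k p K
  have hH := h.isTruncatedPolynomial hM
  have hK := h.isTruncatedPolynomial_of_ker_eq_nilradical hπ hker M'
  have := finite_of_aeval_surjective hH.pow_eq_zero hH.aeval_surjective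
  refine ker_comparison_ofBialgHom_le_augFrobPow hf hsurj ?_
  rw [hH.finrank_eq, hK.finrank_eq, (TruncPoly.isTruncatedPolynomial_gen k p e).finrank_eq,
    Fintype.prod_sum_type, mul_comm]
  simp only [Sum.elim_inl, Sum.elim_inr]

end IsParameterSystem

theorem exists_bijective_comparison_truncPoly (p : ℕ) [Fact p.Prime] [CharP k p] [PerfectField k]
    [Algebra.FiniteType k H] {K : Type*} [CommRing K] [HopfAlgebra k K] {π : H →ₐc[k] K}
    (hπ : Function.Surjective π) (hker : RingHom.ker (π : H →ₐ[k] K) = nilradical H) :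
    ∃ (n : ℕ) (e : Fin n → ℕ) (f : H →ₐ[k] TruncPoly k p e), (∀ i, 0 < e i) ∧
      Function.Bijective ((ofBialgHom π).comparison f) := by
  have hnoeth : IsNoetherianRing H := Algebra.FiniteType.isNoetherianRing k H
  have : CharP H p := charP_of_bialgebra k p H
  obtain ⟨M, r, n, u, t, e, h⟩ := exists_isParameterSystem (k := k) (p := p) (H := H)
  obtain ⟨f, hf, hfM, haug⟩ := h.exists_truncation
  have hnil : IsNilpotent (RingHom.ker (π : H →ₐ[k] K)) :=
    hker ▸ IsNoetherianRing.isNilpotent_nilradical H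
  have hsurj := comparison_ofBialgHom_surjective hπ hnil hf (hker ▸ haug)
  have hle (N : ℕ) : RingHom.ker ((ofBialgHom π).comparison f) ≤ augIdeal k H ^ N := by
    have hfN : ∀ x ∈ augIdeal k H, f x ^ p ^ max M N = 0 := fun x hx =>
      pow_eq_zero_of_le (Nat.pow_le_pow_right (Fact.out : p.Prime).pos (le_max_left M N))
        (hfM x hx)
    calc RingHom.ker ((ofBialgHom π).comparison f)
        ≤ augFrobPow k p H (max M N) :=
          h.ker_comparison_le_augFrobPow hπ hker hfN hsurj (le_max_left M N)
      _ ≤ augIdeal k H ^ max M N := augFrobPow_le_augIdeal_pow _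
      _ ≤ augIdeal k H ^ N := Ideal.pow_le_pow_right (le_max_right M N)
  obtain ⟨c, hc, hcker⟩ := exists_sub_one_mem_forall_mul_eq_zero hle
  have hc : Coalgebra.counit (R := k) c = 1 := by
    simpa [RingHom.mem_ker, sub_eq_zero] using hc
  exact ⟨n, e, f, h.exponent_pos, comparison_ofBialgHom_injective hπ hnil hsurj hc hcker, hsurj⟩

theorem TruncPoly.isReduced_fin_zero (k : Type*) [Field k] (p : ℕ) (e : Fin 0 → ℕ) :
    IsReduced (TruncPoly k p e) := by
  have hspan : Ideal.span (Set.range fun i : Fin 0 =>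
      (MvPolynomial.X i : MvPolynomial (Fin 0) k) ^ p ^ e i) = ⊥ := by
    rw [Set.range_eq_empty, Ideal.span_empty]
  refine (Ideal.isRadical_iff_quotient_reduced _).1 ?_
  exact hspan ▸ Ideal.isRadical_bot

end Splitting

end HopfRed

theorem proposition3p4 {k : Type*} [Field k] (p : ℕ) [Fact p.Prime] [CharP k p] [PerfectField k]
    (H : Type*) [CommRing H] [HopfAlgebra k H] [Algebra.FiniteType k H]
    (hH : nilradical H ≠ ⊥) :
    haveI : (nilradical H).IsHopfIdeal k := HopfRed.nilradical_isHopfIdeal p H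
    ∃ (n : ℕ) (e : Fin n → ℕ), 0 < n ∧ (∀ i, 0 < e i) ∧
      Nonempty (HopfRed.ComoduleAlgebra.Iso
        (HopfRed.ComoduleAlgebra.ofBialgHom
          (Bialgebra.Quotient.mkBialgHom (R := k) (nilradical H)))
        (HopfRed.ComoduleAlgebra.tensor (k := k) (K := H ⧸ nilradical H)
          (HopfRed.TruncPoly k p e))) := by
  have : (nilradical H).IsHopfIdeal k := HopfRed.nilradical_isHopfIdeal p H
  obtain ⟨n, e, f, he, hf⟩ := HopfRed.exists_bijective_comparison_truncPoly p
    (π := Bialgebra.Quotient.mkBialgHom (R := k) (nilradical H)) Ideal.Quotient.mk_surjective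
    Ideal.mk_ker
  refine ⟨n, e, Nat.pos_of_ne_zero ?_, he,
    ⟨⟨AlgEquiv.ofBijective _ hf, HopfRed.ComoduleAlgebra.comparison_colinear _ f⟩⟩⟩
  rintro rfl
  have : IsReduced (HopfRed.TruncPoly k p e) := HopfRed.TruncPoly.isReduced_fin_zero k p e
  have : IsReduced (H ⧸ nilradical H) :=
    (Ideal.isRadical_iff_quotient_reduced _).1 (Ideal.radical_isRadical _)
  have : IsReduced (HopfRed.TruncPoly k p e ⊗[k] (H ⧸ nilradical H)) :=
    HopfRed.isReduced_tensorProduct p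
  have : IsReduced H := isReduced_of_injective _ hf.1
  exact hH (nilradical_eq_zero H)
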